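/- Let $\Omega$ be a finite alphabet with $|\Omega|=q\ge 2$, let $k\ge 3$, and let $P:\Omega^k\to\{0,1\}$ be a predicate that is not identically $1$. A probability distribution on $\Omega^k$ is $t$-wise uniform if its marginal on every set of $t$ coordinates is uniform; $P$ supports a $t$-wise uniform distribution if some $t$-wise uniform distribution is concentrated on $P^{-1}(1)$. Assume that $P$ supports a pairwise ($2$-wise) uniform distribution, and let $\mathcal C(P)$ be the minimum integer $3\le\tau\le k$ for which $P$ does not support a $\tau$-wise uniform distribution. Let $L$ be a nonempty set of permutations of $\Omega$, and let $P^{L}$ be the set of all predicates $x\mapsto P(\ell_1(x_1),\dots,\ell_k(x_k))$ with $\ell_1,\dots,\ell_k\in L$. (For $\Omega=\{0,1\}$ and $L$ consisting of the identity and the negation, $P^{L}=P^{\pm}$ is the family of the predicates obtained by letting $P$ act on literals.) A random instance of $\mathrm{CSP}(P^{L})$ with $n\ge k$ variables and $m$ constraints consists of $m$ independent constraints $(Q,S)$, with $Q\in P^{L}$ uniformly random and $S=(S_1,\dots,S_k)$ a uniformly random tuple of $k$ distinct variables in $[n]$. Use real indeterminates $x_{i,c}$ ($i\in[n]$, $c\in\Omega$).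 A degree-$d$ pseudoexpectation is a linear functional $\widetilde{\mathbf E}$ on real polynomials of degree at most $d$ with $\widetilde{\mathbf E}[1]=1$ and $\widetilde{\mathbf E}[p^2]\ge 0$ whenever $\deg p\le d/2$; it satisfies the identity $p=0$ if $\widetilde{\mathbf E}[pr]=0$ for every polynomial $r$ with $\deg p+\deg r\le d$. Degree-$d$ SOS fails to (weakly) refute an instance if there is a degree-$d$ pseudoexpectation that satisfies the identities $\sum_{c\in\Omega}x_{i,c}=1$ and $x_{i,c}^2=x_{i,c}$ for all $i,c$, and $$\sum_{c\in\Omega^k:\,Q(c)=1}\ \prod_{j=1}^k x_{S_j,c_j}=1$$ for every constraint $(Q,S)$ of the instance. Then there is a universal constant $C>0$ (independent of $q$, $\Omega$, $L$, $k$, $P$, $n$, $m$, $\Delta$, $\beta$) such that the following holds. Let $\Delta\ge 10$, let $m=\Delta n$ be an integer, and let $0<\beta<1$. Except with probability at most $\beta$ over a random instance $\mathcal I$ of $\mathrm{CSP}(P^{L})$ with $n$ variables and $m$ constraints, degree-$\lfloor D\rfloor$ SOS fails to refute $\mathcal I$, where $$D=\frac{\beta^{C/\mathcal C(P)}}{k\cdot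 2^{Ck/\mathcal C(P)}}\cdot\frac{n}{\Delta^{2/(\mathcal C(P)-2)}\,\log\Delta}.$$ -/

import Mathlib

namespace RandomCSP

/-! ### Predicates, `t`-wise uniformity, complexity -/

/-- A `k`-ary predicate over the alphabet `Ω`. -/
abbrev Predicate (Ω : Type*) (k : ℕ) : Type _ := (Fin k → Ω) → Bool

/-- `μ` is `t`-wise uniform: its marginal on every set `T` of `t` coordinates is uniform, i.e. every
local assignment on `T` (given as the restriction of some `y` to `T`) has probability `|Ω|⁻ᵗ`. -/
def IsWiseUniform {Ω : Type*} [Fintype Ω] [DecidableEq Ω] {k : ℕ} (t : ℕ)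
    (μ : (Fin k → Ω) → ℝ) : Prop :=
  ∀ T : Finset (Fin k), T.card = t → ∀ y : Fin k → Ω,
    ∑ x with ∀ i ∈ T, x i = y i, μ x = ((Fintype.card Ω : ℝ) ^ t)⁻¹

/-- `P` supports a `t`-wise uniform distribution: some `t`-wise uniform probability distribution
on `Ω ^ k` is concentrated on the satisfying assignments of `P`. -/
def SupportsUniform {Ω : Type*} [Fintype Ω] [DecidableEq Ω] {k : ℕ} (P : Predicate Ω k)
    (t : ℕ) : Prop :=
  ∃ μ ∈ stdSimplex ℝ (Fin k → Ω), IsWiseUniform t μ ∧ ∀ x, P x = false → μ x = 0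

/-- The complexity `C(P)`: the minimum integer `3 ≤ τ ≤ k` such that `P` does not support a
`τ`-wise uniform distribution.  It exists as soon as `3 ≤ k` and `P` is not identically true. -/
noncomputable def complexity {Ω : Type*} [Fintype Ω] [DecidableEq Ω] {k : ℕ}
    (P : Predicate Ω k) : ℕ :=
  sInf {τ | 3 ≤ τ ∧ τ ≤ k ∧ ¬ SupportsUniform P τ}

/-! ### Random CSPs -/

/-- The family of all predicates obtained by letting `P` act on literals, where a literal is a
variable to which one of the permutations of `Ω` in `L` is applied.  For `Ω = Bool` and
`L = Set.univ` (the identity and the negation) this is the family `P^±` of the `2 ^ k` predicates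
obtained from `P` by possibly negating its inputs. -/
def literalFamily {Ω : Type*} {k : ℕ} (P : Predicate Ω k) (L : Set (Equiv.Perm Ω)) :
    Set (Predicate Ω k) :=
  {Q | ∃ ℓ : Fin k → Equiv.Perm Ω, (∀ i, ℓ i ∈ L) ∧ Q = fun x => P (fun i => ℓ i (x i))}

/-- An instance of `CSP(F)` with `n` variables: a list of `m` constraints, each consisting of a
predicate from `F` and a scope of `k` distinct variables. -/
abbrev CSPInstance {Ω : Type*} {k : ℕ} (F : Set (Predicate Ω k)) (n m : ℕ) : Type _ :=
  Fin m → F × (Fin k ↪ Fin n)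

/-- The probability of the event `A` under the uniform distribution on the finite set `α`. -/
noncomputable def uniformProb {α : Type*} (A : Set α) : ℝ :=
  (A.ncard : ℝ) / (Nat.card α : ℝ)

/-! ### Sum of squares -/

open MvPolynomial in
/-- The polynomial in the indeterminates `X (i, c)` (standing for the indicator of "variable `i` is
assigned `c`") that indicates that the assignment to the scope `S` satisfies `Q`. -/
noncomputable def satPoly {Ω : Type*} [Fintype Ω] {k n : ℕ} (Q : Predicate Ω k)
    (S : Fin k ↪ Fin n) : MvPolynomial (Fin n × Ω) ℝ :=
  ∑ c with Q c = true, ∏ j, X (S j, c j)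

/-- `E` is a degree-`d` pseudoexpectation (with positive semidefiniteness).  A linear functional on
the polynomials of degree at most `d` is represented by any linear extension to all polynomials;
only values on polynomials of degree at most `d` matter. -/
structure IsPseudoexpectation {σ : Type*} (d : ℕ) (E : MvPolynomial σ ℝ →ₗ[ℝ] ℝ) : Prop where
  map_one : E 1 = 1
  sq_nonneg : ∀ p : MvPolynomial σ ℝ, 2 * p.totalDegree ≤ d → 0 ≤ E (p ^ 2)

/-- The degree-`d` pseudoexpectation `E` satisfies the polynomial identity `p = 0`. -/
def SatisfiesIdentity {σ : Type*} (d : ℕ) (E : MvPolynomial σ ℝ →ₗ[ℝ] ℝ)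
    (p : MvPolynomial σ ℝ) : Prop :=
  ∀ r : MvPolynomial σ ℝ, p.totalDegree + r.totalDegree ≤ d → E (p * r) = 0

open MvPolynomial in
/-- Degree-`d` SOS fails to (weakly) refute the instance `I`: there is a degree-`d`
pseudoexpectation satisfying the identities that say that the indeterminates encode an assignment
in `Ω ^ n`, and, for each constraint of `I`, the identity that the constraint is satisfied. -/
def SOSFailsToRefute {Ω : Type*} [Fintype Ω] {k n m : ℕ} {F : Set (Predicate Ω k)} (d : ℕ)
    (I : CSPInstance F n m) : Prop :=
  ∃ E : MvPolynomial (Fin n × Ω) ℝ →ₗ[ℝ] ℝ,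
    IsPseudoexpectation d E ∧
    (∀ i : Fin n, SatisfiesIdentity d E (∑ c : Ω, X (i, c) - 1)) ∧
    (∀ (i : Fin n) (c : Ω), SatisfiesIdentity d E (X (i, c) ^ 2 - X (i, c))) ∧
    ∀ f : Fin m, SatisfiesIdentity d E (satPoly (I f).1.1 (I f).2 - 1)

/-- The degree bound `β^(C/τ) / (k · 2^(C k/τ)) · n / (Δ^(2/(τ-2)) log Δ)`. -/
noncomputable def degreeBound (C β Δ : ℝ) (k τ n : ℕ) : ℝ :=
  β ^ (C / (τ : ℝ)) / ((k : ℝ) * (2 : ℝ) ^ (C * (k : ℝ) / (τ : ℝ))) *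
    ((n : ℝ) / (Δ ^ (2 / ((τ : ℝ) - 2)) * Real.log Δ))

end RandomCSP

open RandomCSP

/-!
For `ζ = 1 / log Δ`, a union bound shows that, except with probability at most `β`, any `c`
constraints of the instance with `c` at most about `D * log Δ` cover at least
`(k - (τ - ζ) / 2) * c` variables, where `τ = 𝒞(P)`. On such an instance the closure of a set `A` of
variables is a maximal set of constraints that has few variables outside `A` for its size;
expansion keeps closures small. The pseudoexpectation integrates a monomial against the product of
`(τ - 1)`-wise uniform densities of the constraints in the closure of its variables. Any further
constraint has few enough variables in common with the closure and the other constraints that it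
can be integrated out by `(τ - 1)`-wise uniformity, so larger sets of constraints give the same
value, and the identities hold because they hold locally. Since sums of closures become too large
for a polynomial as a whole, positivity is shown by a Gram–Schmidt process over the sets of
variables: projections are computed within closures, and the resulting components are orthogonal
globally, again by integrating out.
-/

namespace RandomCSP

open Finset MvPolynomial
open scoped BigOperators

section Averaging

variable {ι κ Ω : Type*} [Fintype ι] [DecidableEq ι] [Fintype Ω]

theorem expect_mul_expect_piecewise (W : Finset ι) {a : (ι → Ω) → ℝ} (ha : DependsOn a W)
    (g : (ι → Ω) → ℝ) :
    𝔼 x, a x * 𝔼 y, g (W.piecewise x y) = 𝔼 x, a x * g x := by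
  cases isEmpty_or_nonempty (ι → Ω)
  · simp
  have hinv : Function.Involutive fun p : (ι → Ω) × (ι → Ω) =>
      (W.piecewise p.1 p.2, W.piecewise p.2 p.1) := fun p => by
    ext i <;> by_cases hi : i ∈ W <;> simp [hi]
  calc 𝔼 x, a x * 𝔼 y, g (W.piecewise x y)
      = 𝔼 p : (ι → Ω) × (ι → Ω), a (W.piecewise p.1 p.2) * g (W.piecewise p.1 p.2) := by
        rw [← univ_product_univ, expect_product]
        refine expect_congr rfl fun x _ => ?_
        rw [mul_expect]
        refine expect_congr rfl fun y _ => ?_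
        rw [ha fun i hi => (W.piecewise_eq_of_mem x y hi).symm]
    _ = 𝔼 p : (ι → Ω) × (ι → Ω), a p.1 * g p.1 :=
        Fintype.expect_equiv (hinv.toPerm _) _ _ fun _ => rfl
    _ = 𝔼 x, a x * g x := by
        rw [← univ_product_univ, expect_product]
        simp only [Fintype.expect_const]

theorem dependsOn_expect_piecewise {W Y : Finset ι} {g : (ι → Ω) → ℝ} (hg : DependsOn g Y) :
    DependsOn (fun x => 𝔼 y, g (W.piecewise x y)) ↑(W ∩ Y) := fun x x' hxx' =>
  expect_congr rfl fun y _ => hg fun i hi => by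
    by_cases hW : i ∈ W
    · simpa [hW] using hxx' i (mem_coe.2 (mem_inter.2 ⟨hW, hi⟩))
    · simp [hW]

theorem expect_comp_embedding [Nonempty Ω] [Fintype κ] [DecidableEq κ] (S : κ ↪ ι)
    (φ : (κ → Ω) → ℝ) : 𝔼 y : ι → Ω, φ (y ∘ S) = 𝔼 z, φ z := by
  have hinv : Function.Involutive fun p : (ι → Ω) × (κ → Ω) =>
      (Function.extend S p.2 p.1, p.1 ∘ S) := fun p => by
    ext i
    · by_cases hi : ∃ j, S j = i
      · obtain ⟨j, rfl⟩ := hi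
        simp [S.injective.extend_apply]
      · simp [Function.extend_apply' _ _ _ hi]
    · simp [S.injective.extend_apply]
  calc 𝔼 y : ι → Ω, φ (y ∘ S)
      = 𝔼 p : (ι → Ω) × (κ → Ω), φ (p.1 ∘ S) := by
        rw [← univ_product_univ, expect_product]
        simp only [Fintype.expect_const]
    _ = 𝔼 p : (ι → Ω) × (κ → Ω), φ p.2 :=
        Fintype.expect_equiv (hinv.toPerm _) _ _ fun _ => rfl
    _ = 𝔼 z, φ z := by
        rw [← univ_product_univ, expect_product]
        simp only [Fintype.expect_const]

theorem card_filter_forall_mem_eq (J : Finset ι) (w : ι → Ω)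
    [DecidablePred fun x : ι → Ω => ∀ i ∈ J, x i = w i] :
    #{x : ι → Ω | ∀ i ∈ J, x i = w i} = Fintype.card Ω ^ #Jᶜ := by
  have hpi : ({x : ι → Ω | ∀ i ∈ J, x i = w i} : Finset (ι → Ω))
      = Fintype.piFinset fun i => if i ∈ J then {w i} else univ := by
    ext x
    simp only [mem_filter_univ, Fintype.mem_piFinset]
    exact forall_congr' fun i => by by_cases hi : i ∈ J <;> simp [hi]
  have hcard : ∀ i, #(if i ∈ J then {w i} else (univ : Finset Ω))
      = if i ∈ Jᶜ then Fintype.card Ω else 1 := fun i => by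
    by_cases hi : i ∈ J <;> simp [hi]
  rw [hpi, Fintype.card_piFinset]
  simp only [hcard, prod_ite_mem, univ_inter, prod_const]

end Averaging

section WiseUniform

variable {ι Ω : Type*} [Fintype ι] [DecidableEq ι] [Fintype Ω] [DecidableEq Ω] {k t : ℕ}
  {μ : (Fin k → Ω) → ℝ}

theorem IsWiseUniform.expect_piecewise (hμ : IsWiseUniform t μ) {J : Finset (Fin k)}
    (hJ : #J = t) (w : Fin k → Ω) :
    𝔼 z, (Fintype.card Ω : ℝ) ^ k * μ (J.piecewise w z) = 1 := by
  set q : ℝ := (Fintype.card Ω : ℝ)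
  set a : (Fin k → Ω) → ℝ := fun x => if ∀ i ∈ J, x i = w i then 1 else 0
  have ha : DependsOn a J := fun x y hxy => by
    simp only [a]
    congr! 3 with i hi
    rw [hxy i hi]
  have hcard : (Fintype.card (Fin k → Ω) : ℝ) = q ^ t * q ^ #Jᶜ := by
    rw [← pow_add, ← hJ, card_add_card_compl, Fintype.card_fin, Fintype.card_fun,
      Fintype.card_fin, Nat.cast_pow]
  have hk : q ^ k = q ^ t * q ^ #Jᶜ := by rw [← hcard]; simp [q]
  have hne : (Fintype.card (Fin k → Ω) : ℝ) ≠ 0 :=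
    Nat.cast_ne_zero.2 (Fintype.card_pos_iff.2 ⟨w⟩).ne'
  have hqt : q ^ t ≠ 0 := left_ne_zero_of_mul (hcard ▸ hne)
  have hqJ : q ^ #Jᶜ ≠ 0 := right_ne_zero_of_mul (hcard ▸ hne)
  have hsum : ∑ x, a x * (q ^ k * μ x) = q ^ #Jᶜ := by
    simp only [a, ite_mul, one_mul, zero_mul, ← sum_filter, ← mul_sum]
    rw [hμ J hJ w, hk, mul_comm (q ^ t), mul_inv_cancel_right₀ hqt]
  have hfix : ∀ x, a x * 𝔼 y, q ^ k * μ (J.piecewise x y)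
      = a x * 𝔼 y, q ^ k * μ (J.piecewise w y) := fun x => by
    by_cases hx : ∀ i ∈ J, x i = w i
    · simp only [J.piecewise_congr hx fun _ _ => rfl]
    · simp [a, hx]
  have key := expect_mul_expect_piecewise J ha fun x => q ^ k * μ x
  simp only [hfix, ← expect_mul] at key
  rw [Fintype.expect_eq_sum_div_card, Fintype.expect_eq_sum_div_card (f := fun x => a x * _), hsum,
    sum_boole, card_filter_forall_mem_eq, Nat.cast_pow, div_mul_eq_mul_div,
    div_left_inj' hne] at key
  exact mul_left_cancel₀ hqJ (key.trans (mul_one _).symm)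

/-- It suffices to retain `t` coordinates of the scope including all those in `R`: averaging over
the others turns the density into the constant `1`. -/
theorem IsWiseUniform.expect_mul_density [Nonempty Ω] (hμ : IsWiseUniform t μ) (htk : t ≤ k)
    (S : Fin k ↪ ι) {R : Finset ι} (hR : #{j | S j ∈ R} ≤ t) {g : (ι → Ω) → ℝ}
    (hg : DependsOn g R) :
    𝔼 x, g x * ((Fintype.card Ω : ℝ) ^ k * μ (x ∘ S)) = 𝔼 x, g x := by
  obtain ⟨J, hRJ, hJ⟩ := exists_superset_card_eq hR (by simpa using htk)
  set A : Finset ι := (Jᶜ.map S)ᶜ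
  have hSA : ∀ j, S j ∈ A ↔ j ∈ J := by simp [A]
  have hRA : R ⊆ A := fun i hi => by
    simp only [A, mem_compl, mem_map, not_exists, not_and]
    rintro j hj rfl
    exact hj (hRJ (by simpa using hi))
  have hcomp : ∀ x y : ι → Ω, A.piecewise x y ∘ S = J.piecewise (x ∘ S) (y ∘ S) := fun x y => by
    ext j
    simp only [Function.comp_apply, Finset.piecewise, hSA]
  calc 𝔼 x, g x * ((Fintype.card Ω : ℝ) ^ k * μ (x ∘ S))
      = 𝔼 x, g x * 𝔼 y, (Fintype.card Ω : ℝ) ^ k * μ (A.piecewise x y ∘ S) :=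
        (expect_mul_expect_piecewise A (hg.mono (coe_subset.2 hRA))
          fun x => (Fintype.card Ω : ℝ) ^ k * μ (x ∘ S)).symm
    _ = 𝔼 x, g x := expect_congr rfl fun x _ => by
        simp only [hcomp]
        rw [expect_comp_embedding S fun z => (Fintype.card Ω : ℝ) ^ k * μ (J.piecewise (x ∘ S) z),
          hμ.expect_piecewise hJ, mul_one]

end WiseUniform

theorem dependsOn_mul {ι Ω : Type*} {a b : (ι → Ω) → ℝ} {s : Set ι} (ha : DependsOn a s)
    (hb : DependsOn b s) : DependsOn (a * b) s := fun x y hxy => by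
  rw [Pi.mul_apply, Pi.mul_apply, ha hxy, hb hxy]

/-- A family of densities on `Ω ^ ι`, relative to the uniform measure. Each of them depends on a
scope of `k` coordinates and looks uniform on any fewer than `τ` of these: it is the density of the
`(τ - 1)`-wise uniform distribution attached to a constraint. -/
structure FactorSystem (ι Ω κ : Type*) [Fintype ι] [DecidableEq ι] [Fintype Ω] (k τ : ℕ) where
  scope : κ → Finset ι
  density : κ → (ι → Ω) → ℝ
  card_scope : ∀ f, #(scope f) = k
  density_nonneg : ∀ f, 0 ≤ density f
  dependsOn_density : ∀ f, DependsOn (density f) (scope f)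
  expect_mul_density : ∀ (f) (R : Finset ι), #{v ∈ scope f | v ∈ R} < τ →
    ∀ g : (ι → Ω) → ℝ, DependsOn g R → 𝔼 x, g x * density f x = 𝔼 x, g x

namespace FactorSystem

variable {ι Ω κ : Type*} [Fintype ι] [DecidableEq ι] [Fintype Ω] {k τ : ℕ}
  (G : FactorSystem ι Ω κ k τ)

/-- The coordinates occurring in the scopes of `U`. -/
def nbhd (U : Finset κ) : Finset ι := U.biUnion G.scope

/-- The product of the densities of the factors of `U`. -/
def weight (U : Finset κ) : (ι → Ω) → ℝ := ∏ f ∈ U, G.density f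

theorem nbhd_mono {U U' : Finset κ} (h : U ⊆ U') : G.nbhd U ⊆ G.nbhd U' :=
  biUnion_subset_biUnion_of_subset_left _ h

theorem scope_subset_nbhd {U : Finset κ} {f : κ} (h : f ∈ U) : G.scope f ⊆ G.nbhd U :=
  subset_biUnion_of_mem _ h

@[simp] theorem nbhd_empty : G.nbhd ∅ = ∅ := biUnion_empty

@[simp] theorem weight_empty : G.weight ∅ = 1 := prod_empty

theorem weight_nonneg (U : Finset κ) : 0 ≤ G.weight U :=
  prod_nonneg fun f _ => G.density_nonneg f

theorem dependsOn_weight (U : Finset κ) : DependsOn (G.weight U) (G.nbhd U) := fun x y hxy => by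
  rw [weight, prod_apply, prod_apply]
  exact prod_congr rfl fun f hf =>
    G.dependsOn_density f fun i hi => hxy i (G.scope_subset_nbhd hf hi)

section Tight

/-- The number of factors of `K` whose scope contains the coordinate `v`. -/
def degree (K : Finset κ) (v : ι) : ℕ := #{f ∈ K | v ∈ G.scope f}

/-- Every factor of `K` has at least `τ` coordinates that lie in `R` or in another factor of `K`, so
that none of them can be integrated out while the coordinates in `R` are retained. -/
def IsTight (R : Finset ι) (K : Finset κ) : Prop :=
  ∀ f ∈ K, τ ≤ #{v ∈ G.scope f | v ∈ R ∨ 2 ≤ G.degree K v}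

variable {G}

theorem one_le_degree {K : Finset κ} {v : ι} (hv : v ∈ G.nbhd K) : 1 ≤ G.degree K v := by
  obtain ⟨f, hf, hvf⟩ := mem_biUnion.1 hv
  exact card_pos.2 ⟨f, mem_filter.2 ⟨hf, hvf⟩⟩

theorem two_le_degree [DecidableEq κ] {K : Finset κ} {f : κ} {v : ι} (hf : f ∈ K)
    (hvf : v ∈ G.scope f) (hv : v ∈ G.nbhd (K.erase f)) : 2 ≤ G.degree K v := by
  obtain ⟨f', hf', hvf'⟩ := mem_biUnion.1 hv
  exact one_lt_card.2 ⟨f, mem_filter.2 ⟨hf, hvf⟩, f',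
    mem_filter.2 ⟨mem_of_mem_erase hf', hvf'⟩, (ne_of_mem_erase hf').symm⟩

theorem sum_degree (K : Finset κ) (p : ι → Prop) [DecidablePred p] :
    ∑ v ∈ G.nbhd K with p v, G.degree K v = ∑ f ∈ K, #{v ∈ G.scope f | p v} := by
  calc ∑ v ∈ G.nbhd K with p v, G.degree K v
      = ∑ f ∈ K, #{v ∈ {v ∈ G.nbhd K | p v} | v ∈ G.scope f} :=
        sum_card_bipartiteAbove_eq_sum_card_bipartiteBelow fun v f => v ∈ G.scope f
    _ = ∑ f ∈ K, #{v ∈ G.scope f | p v} := sum_congr rfl fun f hf => by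
        rw [filter_comm, filter_mem_eq_inter, inter_eq_right.2 (G.scope_subset_nbhd hf)]

variable (G) in
theorem exists_isTight (R : Finset ι) (K : Finset κ) :
    ∃ K' ⊆ K, G.IsTight R K' ∧ ∀ g : (ι → Ω) → ℝ, DependsOn g R →
      𝔼 x, g x * G.weight K x = 𝔼 x, g x * G.weight K' x := by
  classical
  induction K using Finset.strongInduction with
  | H K ih =>
    by_cases hK : G.IsTight R K
    · exact ⟨K, Subset.rfl, hK, fun _ _ => rfl⟩
    obtain ⟨f, hf, hlt⟩ : ∃ f ∈ K, #{v ∈ G.scope f | v ∈ R ∨ 2 ≤ G.degree K v} < τ := by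
      simpa only [IsTight, not_forall, not_le, exists_prop] using hK
    obtain ⟨K', hK', htight, hpeel⟩ := ih (K.erase f) (erase_ssubset hf)
    refine ⟨K', hK'.trans (erase_subset _ _), htight, fun g hg => ?_⟩
    have hfew : #{v ∈ G.scope f | v ∈ R ∪ G.nbhd (K.erase f)} < τ := by
      refine lt_of_le_of_lt (card_le_card fun v hv => ?_) hlt
      obtain ⟨hvf, hv⟩ := mem_filter.1 hv
      exact mem_filter.2 ⟨hvf, (mem_union.1 hv).imp_right (two_le_degree hf hvf)⟩
    have hdep : DependsOn (g * G.weight (K.erase f)) ↑(R ∪ G.nbhd (K.erase f)) :=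
      dependsOn_mul (hg.mono (coe_subset.2 subset_union_left))
        ((G.dependsOn_weight _).mono (coe_subset.2 subset_union_right))
    have hweight : g * G.weight K = g * G.weight (K.erase f) * G.density f := by
      rw [mul_assoc, weight, weight, prod_erase_mul K _ hf]
    calc 𝔼 x, (g * G.weight K) x
        = 𝔼 x, (g * G.weight (K.erase f)) x * G.density f x := by rw [hweight]; rfl
      _ = 𝔼 x, g x * G.weight (K.erase f) x := G.expect_mul_density f _ hfew _ hdep
      _ = 𝔼 x, g x * G.weight K' x := hpeel g hg

theorem IsTight.le_sum_degree {R : Finset ι} {K : Finset κ} (hK : G.IsTight R K) :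
    τ * #K ≤ ∑ v ∈ G.nbhd K with v ∈ R ∨ 2 ≤ G.degree K v, G.degree K v := by
  rw [sum_degree, mul_comm, ← smul_eq_mul]
  exact card_nsmul_le_sum _ _ _ hK

theorem IsTight.card_le {W T : Finset ι} {K : Finset κ} (hK : G.IsTight (W ∪ T) K) :
    2 * #(G.nbhd K \ W) + #(W ∩ G.nbhd K) + τ * #K ≤ 2 * k * #K + #(T \ W) := by
  have htotal : ∑ v ∈ G.nbhd K, G.degree K v = k * #K := by
    have h := sum_degree (G := G) K fun _ => True
    simp only [filter_true, G.card_scope, sum_const, smul_eq_mul] at h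
    rw [h, mul_comm]
  -- The claim is this inequality summed over the coordinates: the third terms add up to `τ * #K` or
  -- more because `K` is tight.
  have hpt : ∀ v ∈ G.nbhd K,
      2 * (if v ∉ W then 1 else 0) + (if v ∈ W then 1 else 0)
        + (if v ∈ W ∪ T ∨ 2 ≤ G.degree K v then G.degree K v else 0)
      ≤ 2 * G.degree K v + (if v ∈ T \ W then 1 else 0) := fun v hv => by
    have hdeg := one_le_degree hv
    simp only [mem_union, mem_sdiff]
    split_ifs <;> grind
  have hsum := sum_le_sum hpt
  simp only [sum_add_distrib, ← mul_sum, ← sum_filter, sum_const, smul_eq_mul, mul_one, htotal,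
    filter_notMem_eq_sdiff, filter_mem_eq_inter] at hsum
  have hshared := hK.le_sum_degree
  have hTW : #(G.nbhd K ∩ (T \ W)) ≤ #(T \ W) := card_le_card inter_subset_right
  rw [inter_comm W, mul_assoc]
  omega

end Tight

end FactorSystem

/-- Any `c ≤ M` of the given scopes cover at least `a * c` points together. -/
def IsExpanding {ι κ : Type*} [DecidableEq ι] (scope : κ → Finset ι) (M : ℕ) (a : ℝ) : Prop :=
  ∀ U : Finset κ, #U ≤ M → a * #U ≤ #(U.biUnion scope)

theorem card_inter_union_lt_or_eq {ι : Type*} [DecidableEq ι] {W T N : Finset ι}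
    (hN : N = ∅ ∨ #(W ∩ N) < #(T \ W)) :
    #(W ∩ (T ∪ N)) < #T ∨ W ∩ (T ∪ N) = T := by
  have hT : #(T ∩ W) + #(T \ W) = #T := card_inter_add_card_sdiff T W
  rw [inter_union_distrib_left, inter_comm W T]
  rcases hN with rfl | hN
  · rw [inter_empty, union_empty]
    exact (card_le_card inter_subset_left).lt_or_eq.imp_right
      (eq_of_subset_of_card_le inter_subset_left ·.ge)
  · have := card_union_le (T ∩ W) (W ∩ N)
    omega

namespace FactorSystem

variable {ι Ω κ : Type*} [Fintype ι] [DecidableEq ι] [Fintype Ω] {k τ : ℕ}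
  (G : FactorSystem ι Ω κ k τ)

section Closure

/-- The set `U` of factors has at most `(k - τ / 2) * #U` coordinates outside `A`. -/
def IsCheap (A : Finset ι) (U : Finset κ) : Prop :=
  2 * #(G.nbhd U \ A) + τ * #U ≤ 2 * k * #U

/-- `U` is a closure of `A`: a maximal cheap set of at most `M` factors. -/
def IsClosure (M : ℕ) (A : Finset ι) : Finset κ → Prop :=
  Maximal fun U => #U ≤ M ∧ G.IsCheap A U

theorem isCheap_empty (A : Finset ι) : G.IsCheap A ∅ := by
  simp [IsCheap]

theorem exists_isClosure [Finite κ] {M : ℕ} {A : Finset ι} {U : Finset κ} (hU : G.IsCheap A U)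
    (hM : #U ≤ M) : ∃ U', U ⊆ U' ∧ G.IsClosure M A U' :=
  Finite.exists_le_maximal ⟨hM, hU⟩

/-- A choice of a closure for every set of coordinates. -/
noncomputable def closure [Finite κ] (M : ℕ) (A : Finset ι) : Finset κ :=
  (G.exists_isClosure (G.isCheap_empty A) (Nat.zero_le M)).choose

theorem isClosure_closure [Finite κ] (M : ℕ) (A : Finset ι) : G.IsClosure M A (G.closure M A) :=
  (G.exists_isClosure (G.isCheap_empty A) (Nat.zero_le M)).choose_spec.2

variable {G} {M : ℕ}

theorem IsCheap.mono {A B : Finset ι} {U : Finset κ} (h : G.IsCheap A U) (hAB : A ⊆ B) :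
    G.IsCheap B U :=
  le_trans (by gcongr) h

/-- Otherwise `U ∪ K` would be a larger cheap set. -/
theorem IsClosure.card_inter_lt [DecidableEq κ] {A T : Finset ι} {U K : Finset κ}
    (hU : G.IsClosure M A U) (hUK : Disjoint U K) (hK : K.Nonempty) (hM : #(U ∪ K) ≤ M)
    (htight : G.IsTight (G.nbhd U ∪ A ∪ T) K) :
    #((G.nbhd U ∪ A) ∩ G.nbhd K) < #(T \ (G.nbhd U ∪ A)) := by
  have hnot : ¬ G.IsCheap A (U ∪ K) := fun hcheap =>
    hK.ne_empty (disjoint_self.1 (hUK.mono_left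
      (subset_union_right.trans (hU.le_of_ge ⟨hM, hcheap⟩ subset_union_left))))
  have hcheap := hU.prop.2
  unfold IsCheap at hnot hcheap
  have hnew : #(G.nbhd (U ∪ K) \ A) ≤ #(G.nbhd U \ A) + #(G.nbhd K \ (G.nbhd U ∪ A)) := by
    refine (card_le_card fun v => ?_).trans (card_union_le _ _)
    simp only [nbhd, union_biUnion, mem_sdiff, mem_union]
    tauto
  have hcount := htight.card_le
  rw [card_union_of_disjoint hUK, mul_add, mul_add] at hnot
  omega

/-- All factors beyond a closure `U` of `A` can be integrated out, except for a set `K` that meets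
the coordinates of the closure in few points. -/
theorem IsClosure.exists_boundary {A : Finset ι} {U U' : Finset κ} (hU : G.IsClosure M A U)
    (hUU' : U ⊆ U') (hM : #U' ≤ M) (T : Finset ι) :
    ∃ K : Finset κ, (K = ∅ ∨ #((G.nbhd U ∪ A) ∩ G.nbhd K) < #(T \ (G.nbhd U ∪ A))) ∧
      ∀ h : (ι → Ω) → ℝ, DependsOn h ↑(G.nbhd U ∪ A ∪ T) →
        𝔼 x, h x * G.weight U' x = 𝔼 x, h x * G.weight U x * G.weight K x := by
  classical
  obtain ⟨K, hK, htight, hpeel⟩ := G.exists_isTight (G.nbhd U ∪ A ∪ T) (U' \ U)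
  refine ⟨K, K.eq_empty_or_nonempty.imp_right fun hne => ?_, fun h hh => ?_⟩
  · exact hU.card_inter_lt (disjoint_sdiff.mono_right hK) hne
      ((card_le_card (union_subset hUU' (hK.trans sdiff_subset))).trans hM) htight
  · have hdep : DependsOn (h * G.weight U) ↑(G.nbhd U ∪ A ∪ T) :=
      dependsOn_mul hh ((G.dependsOn_weight U).mono
        (coe_subset.2 (subset_union_left.trans subset_union_left)))
    have hweight : h * G.weight U' = h * G.weight U * G.weight (U' \ U) := by
      rw [mul_assoc, mul_comm (G.weight U), weight, weight, weight, prod_sdiff hUU']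
    calc 𝔼 x, (h * G.weight U') x
        = 𝔼 x, (h * G.weight U) x * G.weight (U' \ U) x := by rw [hweight]; rfl
      _ = 𝔼 x, h x * G.weight U x * G.weight K x := hpeel _ hdep

end Closure

section Expansion

variable {M d : ℕ}

/-- Closures of at most `d` coordinates have at most `M / 2` factors, so that the union of two of
them is still within the scale `M`, and the closure of the empty set is empty. -/
structure HasSmallClosures (M d : ℕ) : Prop where
  two_mul_card_le : ∀ {A U}, #A ≤ d → #U ≤ M → G.IsCheap A U → 2 * #U ≤ M
  eq_empty : ∀ {U}, #U ≤ M → G.IsCheap ∅ U → U = ∅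

variable {G}

theorem IsCheap.mul_card_le {ζ : ℝ} (hG : IsExpanding G.scope M (k - (τ - ζ) / 2)) {A : Finset ι}
    {U : Finset κ} (hU : G.IsCheap A U) (hM : #U ≤ M) : ζ * #U ≤ 2 * #A := by
  have hexp : (k - (τ - ζ) / 2) * #U ≤ (#(G.nbhd U) : ℝ) := hG U hM
  have hcheap : (2 * #(G.nbhd U \ A) + τ * #U : ℝ) ≤ 2 * k * #U := mod_cast hU
  have hsdiff : (#(G.nbhd U) : ℝ) ≤ #(G.nbhd U \ A) + #A :=
    mod_cast card_le_card_sdiff_add_card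
  linarith

theorem hasSmallClosures_of_isExpanding {ζ : ℝ} (hζ : 0 < ζ) (hd : 4 * d ≤ ζ * M)
    (hG : IsExpanding G.scope M (k - (τ - ζ) / 2)) : G.HasSmallClosures M d where
  two_mul_card_le {A U} hA hM hU := by
    have hcard := hU.mul_card_le hG hM
    have hA' : (#A : ℝ) ≤ d := mod_cast hA
    have hle : (2 * #U : ℝ) ≤ M := le_of_mul_le_mul_left (by linarith) hζ
    exact mod_cast hle
  eq_empty {U} hM hU := by
    have hcard : ζ * #U ≤ 0 := by simpa using hU.mul_card_le hG hM
    exact card_eq_zero.1 (mod_cast (nonpos_of_mul_nonpos_right hcard hζ).antisymm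
      (Nat.cast_nonneg _))

theorem IsClosure.two_mul_card_le (hG : G.HasSmallClosures M d) {A : Finset ι} {U : Finset κ}
    (hU : G.IsClosure M A U) (hA : #A ≤ d) : 2 * #U ≤ M :=
  hG.two_mul_card_le hA hU.prop.1 hU.prop.2

theorem IsClosure.mem_of_scope_subset (hG : G.HasSmallClosures M d) (hM : 0 < M) (hτ : τ ≤ 2 * k)
    {A : Finset ι} {U : Finset κ} (hU : G.IsClosure M A U) (hA : #A ≤ d) {f : κ}
    (hf : G.scope f ⊆ A) : f ∈ U := by
  classical
  by_contra hfU
  have hcard := hU.two_mul_card_le hG hA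
  have hnbhd : G.nbhd (insert f U) \ A = G.nbhd U \ A := by
    rw [nbhd, biUnion_insert, union_sdiff_distrib, sdiff_eq_empty_iff_subset.2 hf, empty_union,
      nbhd]
  have hcheap : G.IsCheap A (insert f U) := by
    have := hU.prop.2
    unfold IsCheap at this ⊢
    rw [hnbhd, card_insert_of_notMem hfU, mul_add, mul_add]
    omega
  have hle : #(insert f U) ≤ M := by
    rw [card_insert_of_notMem hfU]
    omega
  exact hfU (hU.le_of_ge ⟨hle, hcheap⟩ (subset_insert f U) (mem_insert_self f U))

end Expansion

section LocalExpectation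

/-- The expectation relative to the density `G.weight U`. -/
noncomputable def localExp (U : Finset κ) : ((ι → Ω) → ℝ) →ₗ[ℝ] ℝ where
  toFun h := 𝔼 x, h x * G.weight U x
  map_add' g h := by simp only [Pi.add_apply, add_mul, expect_add_distrib]
  map_smul' c h := by
    simp only [Pi.smul_apply, smul_eq_mul, mul_assoc, mul_expect, RingHom.id_apply]

theorem localExp_apply (U : Finset κ) (h : (ι → Ω) → ℝ) :
    G.localExp U h = 𝔼 x, h x * G.weight U x := rfl

variable {G} {M d : ℕ}

theorem IsClosure.localExp_eq_of_subset {A : Finset ι} {U U' : Finset κ}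
    (hU : G.IsClosure M A U) (hUU' : U ⊆ U') (hM : #U' ≤ M) {h : (ι → Ω) → ℝ}
    (hh : DependsOn h ↑(G.nbhd U ∪ A)) : G.localExp U' h = G.localExp U h := by
  obtain ⟨K, hK, hpeel⟩ := hU.exists_boundary hUU' hM ∅
  obtain rfl : K = ∅ := by simpa using hK
  simpa [localExp_apply] using hpeel h (by simpa using hh)

theorem IsClosure.localExp_eq (hG : G.HasSmallClosures M d) {A A' : Finset ι} {U U' : Finset κ}
    (hU : G.IsClosure M A U) (hU' : G.IsClosure M A' U') (hA : #A ≤ d) (hA' : #A' ≤ d)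
    {h : (ι → Ω) → ℝ} (hh : DependsOn h ↑(G.nbhd U ∪ A)) (hh' : DependsOn h ↑(G.nbhd U' ∪ A')) :
    G.localExp U h = G.localExp U' h := by
  classical
  have hcard := hU.two_mul_card_le hG hA
  have hcard' := hU'.two_mul_card_le hG hA'
  have hunion : #(U ∪ U') ≤ M := (card_union_le _ _).trans (by omega)
  rw [← hU.localExp_eq_of_subset subset_union_left hunion hh,
    hU'.localExp_eq_of_subset subset_union_right hunion hh']

/-- Averaging over the coordinates that `f` does not depend on replaces `g`, together with the
factors that cannot be integrated out, by a function of fewer than `#T` coordinates of the closure,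
or of `T` itself. -/
theorem IsClosure.localExp_mul_eq_zero {S T : Finset ι} {U U' : Finset κ}
    (hU : G.IsClosure M S U) (hUU' : U ⊆ U') (hM : #U' ≤ M) {f g : (ι → Ω) → ℝ}
    (hf : DependsOn f ↑(G.nbhd U ∪ S)) (hg : DependsOn g T)
    (horth : ∀ B ⊆ G.nbhd U ∪ S, #B < #T ∨ B = T → ∀ b : (ι → Ω) → ℝ, DependsOn b B →
      G.localExp U (f * b) = 0) :
    G.localExp U' (f * g) = 0 := by
  set W := G.nbhd U ∪ S
  obtain ⟨K, hK, hpeel⟩ := hU.exists_boundary hUU' hM T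
  have hfU : DependsOn (f * G.weight U) W :=
    dependsOn_mul hf ((G.dependsOn_weight U).mono (coe_subset.2 subset_union_left))
  have hgK : DependsOn (g * G.weight K) ↑(T ∪ G.nbhd K) :=
    dependsOn_mul (hg.mono (coe_subset.2 subset_union_left))
      ((G.dependsOn_weight K).mono (coe_subset.2 subset_union_right))
  have hfg : DependsOn (f * g) ↑(W ∪ T) :=
    dependsOn_mul (hf.mono (coe_subset.2 subset_union_left))
      (hg.mono (coe_subset.2 subset_union_right))
  have hB := card_inter_union_lt_or_eq (hK.imp_left fun hK => by rw [hK, nbhd_empty])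
  calc G.localExp U' (f * g)
      = 𝔼 x, (f * g) x * G.weight U x * G.weight K x := hpeel _ hfg
    _ = 𝔼 x, (f * G.weight U) x * (g * G.weight K) x :=
        expect_congr rfl fun x _ => by simp only [Pi.mul_apply]; ring
    _ = 𝔼 x, (f * G.weight U) x * 𝔼 y, (g * G.weight K) (W.piecewise x y) :=
        (expect_mul_expect_piecewise W hfU _).symm
    _ = G.localExp U (f * fun x => 𝔼 y, (g * G.weight K) (W.piecewise x y)) :=
        expect_congr rfl fun x _ => by simp only [Pi.mul_apply]; ring
    _ = 0 := horth _ inter_subset_left hB _ (dependsOn_expect_piecewise hgK)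

end LocalExpectation

end FactorSystem

section Polynomials

variable {ι Ω : Type*}

/-- The values of a polynomial at the points `fun (i, c) => if x i = c then 1 else 0` of the
hypercube, as a function of the assignment `x` that they encode. -/
noncomputable def evalAssignment [DecidableEq Ω] :
    MvPolynomial (ι × Ω) ℝ →ₐ[ℝ] ((ι → Ω) → ℝ) :=
  aeval fun p x => if x p.1 = p.2 then 1 else 0

theorem evalAssignment_X [DecidableEq Ω] (i : ι) (c : Ω) (x : ι → Ω) :
    evalAssignment (X (i, c)) x = if x i = c then 1 else 0 := by
  rw [evalAssignment, aeval_X]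

theorem X_mem_supported_fst {B : Finset ι} {i : ι} (hi : i ∈ B) (c : Ω) :
    (X (i, c) : MvPolynomial (ι × Ω) ℝ) ∈ supported ℝ {v : ι × Ω | v.1 ∈ B} :=
  X_mem_supported.2 hi

theorem exists_evalAssignment_eq [Finite ι] [Finite Ω] [DecidableEq Ω] {B : Finset ι}
    {b : (ι → Ω) → ℝ} (hb : DependsOn b B) :
    ∃ p ∈ supported ℝ {v : ι × Ω | v.1 ∈ B}, evalAssignment p = b := by
  classical
  cases nonempty_fintype ι
  cases nonempty_fintype Ω
  rcases isEmpty_or_nonempty (ι → Ω) with hempty | ⟨⟨x₀⟩⟩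
  · exact ⟨0, zero_mem _, Subsingleton.elim _ _⟩
  refine ⟨∑ y : ι → Ω with ∀ i ∉ B, y i = x₀ i, b y • ∏ i ∈ B, X (i, y i),
    Subalgebra.sum_mem _ fun y _ => Subalgebra.smul_mem _
      (Subalgebra.prod_mem _ fun i hi => X_mem_supported_fst hi _) _, ?_⟩
  ext x
  simp only [map_sum, map_smul, map_prod, Finset.sum_apply, Pi.smul_apply, Finset.prod_apply,
    evalAssignment_X, smul_eq_mul, Finset.prod_ite_zero, prod_const_one, mul_ite, mul_one, mul_zero]
  rw [sum_eq_single_of_mem (B.piecewise x x₀)]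
  · rw [if_pos fun i hi => (B.piecewise_eq_of_mem x x₀ hi).symm]
    exact hb fun i hi => B.piecewise_eq_of_mem x x₀ hi
  · exact mem_filter.2 ⟨mem_univ _, fun i hi => B.piecewise_eq_of_notMem x x₀ hi⟩
  · intro y hy hne
    refine if_neg fun hxy => hne (funext fun i => ?_)
    by_cases hi : i ∈ B
    · rw [B.piecewise_eq_of_mem x x₀ hi, hxy i hi]
    · rw [B.piecewise_eq_of_notMem x x₀ hi, (mem_filter.1 hy).2 i hi]

variable [DecidableEq ι]

/-- The variables whose indeterminates occur in a monomial. -/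
def varSet (s : (ι × Ω) →₀ ℕ) : Finset ι := s.support.image Prod.fst

theorem card_varSet_le (s : (ι × Ω) →₀ ℕ) : #(varSet s) ≤ s.sum fun _ e => e :=
  card_image_le.trans <| (card_eq_sum_ones _).trans_le <|
    sum_le_sum fun _ hi => Nat.one_le_iff_ne_zero.2 (Finsupp.mem_support_iff.1 hi)

theorem varSet_add (s s' : (ι × Ω) →₀ ℕ) : varSet (s + s') = varSet s ∪ varSet s' := by
  ext i
  simp only [varSet, mem_image, mem_union, Finsupp.mem_support_iff, Finsupp.add_apply, ne_eq,
    Nat.add_eq_zero_iff, not_and_or]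
  grind

/-- The polynomials each of whose monomials has its set of variables in `𝒞`. -/
noncomputable def polyOver (𝒞 : Set (Finset ι)) : Submodule ℝ (MvPolynomial (ι × Ω) ℝ) :=
  restrictSupport ℝ {s | varSet s ∈ 𝒞}

theorem mem_polyOver {𝒞 : Set (Finset ι)} {p : MvPolynomial (ι × Ω) ℝ} :
    p ∈ polyOver 𝒞 ↔ ∀ s ∈ p.support, varSet s ∈ 𝒞 := by
  rw [polyOver, mem_restrictSupport_iff]
  rfl

theorem monomial_mem_polyOver {𝒞 : Set (Finset ι)} {s : (ι × Ω) →₀ ℕ} (hs : varSet s ∈ 𝒞) (a : ℝ) :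
    monomial s a ∈ polyOver 𝒞 :=
  (monomial_mem_restrictSupport ℝ).2 (Or.inl hs)

theorem polyOver_mono {𝒞 𝒞' : Set (Finset ι)} (h : 𝒞 ⊆ 𝒞') :
    (polyOver 𝒞 : Submodule ℝ (MvPolynomial (ι × Ω) ℝ)) ≤ polyOver 𝒞' :=
  restrictSupport_mono ℝ fun _ hs => h hs

theorem polyOver_union (𝒞 𝒞' : Set (Finset ι)) :
    (polyOver (𝒞 ∪ 𝒞') : Submodule ℝ (MvPolynomial (ι × Ω) ℝ)) = polyOver 𝒞 ⊔ polyOver 𝒞' := by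
  simp only [polyOver, restrictSupport_eq_span, ← Submodule.span_union, ← Set.image_union]
  rfl

theorem mul_mem_polyOver {𝒞 𝒞' 𝒟 : Set (Finset ι)} (h : ∀ A ∈ 𝒞, ∀ B ∈ 𝒞', A ∪ B ∈ 𝒟)
    {p q : MvPolynomial (ι × Ω) ℝ} (hp : p ∈ polyOver 𝒞) (hq : q ∈ polyOver 𝒞') :
    p * q ∈ polyOver 𝒟 := by
  have hpq := Submodule.mul_mem_mul hp hq
  rw [polyOver, polyOver, ← restrictSupport_add] at hpq
  refine restrictSupport_mono ℝ ?_ hpq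
  rintro _ ⟨s, hs, s', hs', rfl⟩
  exact (congrArg (· ∈ 𝒟) (varSet_add s s')).mpr (h _ hs _ hs')

theorem mem_polyOver_of_totalDegree_le {d : ℕ} {p : MvPolynomial (ι × Ω) ℝ}
    (h : p.totalDegree ≤ d) : p ∈ polyOver {T | #T ≤ d} :=
  mem_polyOver.2 fun s hs => (card_varSet_le s).trans ((le_totalDegree hs).trans h)

theorem mem_polyOver_of_mem_supported {B : Finset ι} {p : MvPolynomial (ι × Ω) ℝ}
    (hp : p ∈ supported ℝ {v : ι × Ω | v.1 ∈ B}) : p ∈ polyOver {T | T ⊆ B} :=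
  mem_polyOver.2 fun s hs => image_subset_iff.2 fun v hv =>
    mem_supported.1 hp ((mem_vars_iff_mem_support v).2 ⟨s, hs, hv⟩)

theorem linearMap_eq_of_mem_polyOver {N : Type*} [AddCommGroup N] [Module ℝ N]
    {𝒞 : Set (Finset ι)} {L L' : MvPolynomial (ι × Ω) ℝ →ₗ[ℝ] N}
    (h : ∀ s, varSet s ∈ 𝒞 → L (monomial s 1) = L' (monomial s 1)) {p : MvPolynomial (ι × Ω) ℝ}
    (hp : p ∈ polyOver 𝒞) : L p = L' p := by
  rw [polyOver, restrictSupport_eq_span] at hp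
  exact LinearMap.eqOn_span (by rintro _ ⟨s, hs, rfl⟩; exact h s hs) hp

variable [DecidableEq Ω]

theorem dependsOn_evalAssignment_monomial (s : (ι × Ω) →₀ ℕ) :
    DependsOn (evalAssignment (monomial s 1)) (varSet s) := fun x y hxy => by
  simp only [evalAssignment, aeval_monomial, map_one, one_mul, Finsupp.prod, prod_apply,
    Pi.pow_apply]
  exact prod_congr rfl fun v hv => by rw [hxy v.1 (mem_coe.2 (mem_image_of_mem Prod.fst hv))]

theorem dependsOn_evalAssignment {𝒞 : Set (Finset ι)} {W : Finset ι} (h𝒞 : ∀ T ∈ 𝒞, T ⊆ W)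
    {p : MvPolynomial (ι × Ω) ℝ} (hp : p ∈ polyOver 𝒞) : DependsOn (evalAssignment p) W :=
  fun x y hxy =>
    linearMap_eq_of_mem_polyOver (L := LinearMap.proj x ∘ₗ evalAssignment.toLinearMap)
      (L' := LinearMap.proj y ∘ₗ evalAssignment.toLinearMap)
      (fun s hs => dependsOn_evalAssignment_monomial s fun i hi => hxy i (h𝒞 _ hs hi)) hp

end Polynomials

theorem exists_weighted_projection {V α : Type*} [AddCommGroup V] [Module ℝ V] [Fintype α]
    {w : α → ℝ} (hw : 0 ≤ w) (φ : V →ₗ[ℝ] (α → ℝ)) (Q : Submodule ℝ V) (p : V) :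
    ∃ q ∈ Q, ∀ q' ∈ Q, ∑ x, φ (p - q) x * φ q' x * w x = 0 := by
  let L : V →ₗ[ℝ] EuclideanSpace ℝ α :=
    (WithLp.linearEquiv 2 ℝ (α → ℝ)).symm.toLinearMap ∘ₗ LinearMap.mulLeft ℝ (fun x => √(w x)) ∘ₗ φ
  have hL : ∀ a b, inner ℝ (L a) (L b) = ∑ x, φ a x * φ b x * w x := fun a b => by
    rw [PiLp.inner_apply]
    refine sum_congr rfl fun x _ => ?_
    change √(w x) * φ b x * (√(w x) * φ a x) = _
    linear_combination φ a x * φ b x * Real.mul_self_sqrt (hw x)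
  obtain ⟨q, hq, hqL⟩ := Submodule.mem_map.1 ((Q.map L).starProjection_apply_mem (L p))
  refine ⟨q, hq, fun q' hq' => ?_⟩
  rw [← hL, map_sub, hqL]
  exact Submodule.starProjection_inner_eq_zero _ _ (Submodule.mem_map_of_mem hq')

namespace FactorSystem

section Pseudoexpectation

variable {ι Ω κ : Type*} [Fintype ι] [DecidableEq ι] [Fintype Ω] [DecidableEq Ω] [Finite κ]
  {k τ : ℕ}

/-- The candidate pseudoexpectation: a monomial is integrated against the factors of the closure of
its set of variables only. -/
noncomputable def pseudoExp (G : FactorSystem ι Ω κ k τ) (M : ℕ) :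
    MvPolynomial (ι × Ω) ℝ →ₗ[ℝ] ℝ :=
  (basisMonomials (ι × Ω) ℝ).constr ℝ fun s =>
    G.localExp (G.closure M (varSet s)) (evalAssignment (monomial s 1))

variable {G : FactorSystem ι Ω κ k τ} {M d : ℕ}

theorem pseudoExp_monomial (s : (ι × Ω) →₀ ℕ) :
    G.pseudoExp M (monomial s 1)
      = G.localExp (G.closure M (varSet s)) (evalAssignment (monomial s 1)) := by
  simpa only [coe_basisMonomials, pseudoExp] using (basisMonomials (ι × Ω) ℝ).constr_basis ℝ
    (fun s => G.localExp (G.closure M (varSet s)) (evalAssignment (monomial s 1))) s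

theorem IsClosure.pseudoExp_eq (hG : G.HasSmallClosures M d) {A : Finset ι} {U : Finset κ}
    (hU : G.IsClosure M A U) (hA : #A ≤ d) {p : MvPolynomial (ι × Ω) ℝ}
    (hp : p ∈ polyOver {T | T ⊆ G.nbhd U ∪ A ∧ #T ≤ d}) :
    G.pseudoExp M p = G.localExp U (evalAssignment p) := by
  refine linearMap_eq_of_mem_polyOver
    (L' := G.localExp U ∘ₗ evalAssignment.toLinearMap) (fun s hs => ?_) hp
  have hdep := dependsOn_evalAssignment_monomial s
  exact (pseudoExp_monomial s).trans <|
    (G.isClosure_closure M (varSet s)).localExp_eq hG hU hs.2 hA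
      (hdep.mono (coe_subset.2 subset_union_right)) (hdep.mono (coe_subset.2 hs.1))

theorem pseudoExp_mul_eq_zero (hG : G.HasSmallClosures M d) {S T : Finset ι} {U : Finset κ}
    (hU : G.IsClosure M S U) (hST : #S + #T ≤ d) {f g : MvPolynomial (ι × Ω) ℝ}
    (hf : f ∈ polyOver {A | A ⊆ G.nbhd U ∪ S ∧ #A ≤ #S}) (hg : g ∈ polyOver {T})
    (horth : ∀ B ⊆ G.nbhd U ∪ S, #B < #T ∨ B = T → ∀ b : (ι → Ω) → ℝ, DependsOn b B →
      G.localExp U (evalAssignment f * b) = 0) :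
    G.pseudoExp M (f * g) = 0 := by
  obtain ⟨U', hUU', hU'⟩ := G.exists_isClosure (hU.prop.2.mono (subset_union_left (s₂ := T)))
    hU.prop.1
  have hfg : f * g ∈ polyOver {A | A ⊆ G.nbhd U' ∪ (S ∪ T) ∧ #A ≤ d} := by
    refine mul_mem_polyOver ?_ hf hg
    rintro A ⟨hAW, hAS⟩ _ rfl
    refine ⟨union_subset (hAW.trans ?_) ?_, (card_union_le _ _).trans (by omega)⟩
    · exact union_subset_union (G.nbhd_mono hUU') subset_union_left
    · exact subset_union_right.trans subset_union_right
  rw [hU'.pseudoExp_eq hG ((card_union_le _ _).trans hST) hfg, map_mul]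
  exact hU.localExp_mul_eq_zero hUU' hU'.prop.1
    (dependsOn_evalAssignment (fun A hA => hA.1) hf)
    (dependsOn_evalAssignment (fun A hA => (Set.mem_singleton_iff.1 hA).subset) hg) horth

theorem IsClosure.pseudoExp_mul_self_nonneg (hG : G.HasSmallClosures M d) {S : Finset ι}
    {U : Finset κ} (hU : G.IsClosure M S U) (hS : 2 * #S ≤ d) {f : MvPolynomial (ι × Ω) ℝ}
    (hf : f ∈ polyOver {A | A ⊆ G.nbhd U ∪ S ∧ #A ≤ #S}) : 0 ≤ G.pseudoExp M (f * f) := by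
  have hff : f * f ∈ polyOver {A | A ⊆ G.nbhd U ∪ S ∧ #A ≤ d} := by
    refine mul_mem_polyOver ?_ hf hf
    rintro A ⟨hAW, hAS⟩ B ⟨hBW, hBS⟩
    exact ⟨union_subset hAW hBW, (card_union_le _ _).trans (by omega)⟩
  rw [hU.pseudoExp_eq hG (by omega) hff, map_mul]
  exact expect_nonneg fun x _ => mul_nonneg (mul_self_nonneg _) (G.weight_nonneg _ x)

/-- The projection of `p` is taken with respect to the local expectation of the closure of `S`,
among the polynomials in the coordinates of that closure; the orthogonality extends to all of
`polyOver 𝒯`. -/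
theorem IsClosure.exists_orthogonal_projection (hG : G.HasSmallClosures M d) {S : Finset ι}
    {U : Finset κ} (hU : G.IsClosure M S U) (hS : 2 * #S ≤ d) {𝒯 : Set (Finset ι)}
    (hle : ∀ T ∈ 𝒯, #T ≤ #S) (hlt : ∀ T, #T < #S → T ∈ 𝒯) {p : MvPolynomial (ι × Ω) ℝ}
    (hp : p ∈ polyOver {S}) :
    ∃ q ∈ polyOver 𝒯, p - q ∈ polyOver {A | A ⊆ G.nbhd U ∪ S ∧ #A ≤ #S} ∧
      ∀ g ∈ polyOver 𝒯, G.pseudoExp M ((p - q) * g) = 0 := by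
  obtain ⟨q, hq, horth⟩ := exists_weighted_projection (G.weight_nonneg U)
    evalAssignment.toLinearMap (polyOver {A | A ∈ 𝒯 ∧ A ⊆ G.nbhd U ∪ S}) p
  have hpq : p - q ∈ polyOver {A | A ⊆ G.nbhd U ∪ S ∧ #A ≤ #S} := by
    refine Submodule.sub_mem _ (polyOver_mono ?_ hp) (polyOver_mono ?_ hq)
    · exact Set.singleton_subset_iff.2 ⟨subset_union_right, le_rfl⟩
    · exact fun A hA => ⟨hA.2, hle A hA.1⟩
  refine ⟨q, polyOver_mono (fun A hA => hA.1) hq, hpq, fun g hg => ?_⟩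
  refine linearMap_eq_of_mem_polyOver (L := G.pseudoExp M ∘ₗ LinearMap.mulLeft ℝ (p - q))
    (L' := 0) (fun s hs => ?_) hg
  have hsS : #(varSet s) ≤ #S := hle _ hs
  refine pseudoExp_mul_eq_zero hG hU (by omega) hpq
    (monomial_mem_polyOver (Set.mem_singleton _) 1) fun B hBW hB b hb => ?_
  obtain ⟨r, hr, rfl⟩ := exists_evalAssignment_eq hb
  have hr𝒯 : r ∈ polyOver {A | A ∈ 𝒯 ∧ A ⊆ G.nbhd U ∪ S} := by
    refine polyOver_mono ?_ (mem_polyOver_of_mem_supported hr)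
    refine fun A (hA : A ⊆ B) => ⟨?_, hA.trans hBW⟩
    rcases hA.eq_or_ssubset with rfl | hAB
    · rcases hB with hB | rfl
      · exact hlt _ (hB.trans_le hsS)
      · exact hs
    · have hBs : #B ≤ #(varSet s) := hB.elim le_of_lt fun h => h ▸ le_rfl
      exact hlt _ ((card_lt_card hAB).trans_le (hBs.trans hsS))
  rw [localExp_apply, Fintype.expect_eq_sum_div_card]
  exact div_eq_zero_iff.2 (Or.inl (horth r hr𝒯))

/-- Gram–Schmidt over the sets of variables, in the order of their sizes. -/
theorem pseudoExp_mul_self_nonneg (hG : G.HasSmallClosures M d) {𝒮 : Finset (Finset ι)}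
    (hsize : ∀ S ∈ 𝒮, 2 * #S ≤ d) (hlower : ∀ S ∈ 𝒮, ∀ T, #T < #S → T ∈ 𝒮)
    {p : MvPolynomial (ι × Ω) ℝ} (hp : p ∈ polyOver (𝒮 : Set (Finset ι))) :
    0 ≤ G.pseudoExp M (p * p) := by
  induction 𝒮 using Finset.induction_on_max_value (α := ℕ) (ι := Finset ι) card
    generalizing p with
  | empty =>
    have hp0 : p = 0 := by
      rw [← support_eq_empty]
      exact eq_empty_of_forall_notMem fun s hs => by simpa using mem_polyOver.1 hp s hs
    rw [hp0, zero_mul, map_zero]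
  | insert S 𝒯 hS𝒯 hmax ih =>
    have hSd : 2 * #S ≤ d := hsize S (mem_insert_self S 𝒯)
    have hlt : ∀ T, #T < #S → T ∈ 𝒯 := fun T hT =>
      mem_of_mem_insert_of_ne (hlower S (mem_insert_self S 𝒯) T hT) (by rintro rfl; omega)
    rw [coe_insert, Set.insert_eq, polyOver_union] at hp
    obtain ⟨p₁, hp₁, p₂, hp₂, rfl⟩ := Submodule.mem_sup.1 hp
    have hU := G.isClosure_closure M S
    obtain ⟨q, hq, hpq, horth⟩ := hU.exists_orthogonal_projection hG hSd hmax hlt hp₁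
    have hsum : q + p₂ ∈ polyOver (𝒯 : Set (Finset ι)) := Submodule.add_mem _ hq hp₂
    have hsquare : (p₁ + p₂) * (p₁ + p₂) = (p₁ - q) * (p₁ - q)
        + (2 : ℝ) • ((p₁ - q) * (q + p₂)) + (q + p₂) * (q + p₂) := by
      rw [two_smul]
      ring
    rw [hsquare, map_add, map_add, map_smul, horth _ hsum, smul_zero, add_zero]
    exact add_nonneg (hU.pseudoExp_mul_self_nonneg hG hSd hpq)
      (ih (fun T hT => hsize T (mem_insert_of_mem hT))
        (fun A hA T hT => hlt T (hT.trans_le (hmax A hA))) hsum)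

theorem isPseudoexpectation_pseudoExp [Nonempty Ω] (hG : G.HasSmallClosures M d) :
    IsPseudoexpectation d (G.pseudoExp M) where
  map_one := by
    have hclosure : G.closure M ∅ = ∅ :=
      hG.eq_empty (G.isClosure_closure M ∅).prop.1 (G.isClosure_closure M ∅).prop.2
    have hvar : varSet (0 : (ι × Ω) →₀ ℕ) = ∅ := rfl
    calc G.pseudoExp M (monomial 0 1)
        = G.localExp ∅ 1 := by
          rw [pseudoExp_monomial, hvar, hclosure, monomial_zero', map_one, map_one]
      _ = 1 := by simp [localExp_apply]
  sq_nonneg p hp := by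
    rw [pow_two]
    refine pseudoExp_mul_self_nonneg hG (𝒮 := {S | #S ≤ p.totalDegree}) ?_ ?_ ?_
    · intro S hS
      have := (mem_filter_univ S).1 hS
      omega
    · intro S hS T hT
      have := (mem_filter_univ S).1 hS
      exact (mem_filter_univ T).2 (by omega)
    · simpa using mem_polyOver_of_totalDegree_le (p := p) le_rfl

/-- An identity that holds pointwise wherever the factors of closures are positive. -/
theorem satisfiesIdentity_pseudoExp (hG : G.HasSmallClosures M d) {B : Finset ι}
    {p : MvPolynomial (ι × Ω) ℝ} (hp : p ∈ supported ℝ {v : ι × Ω | v.1 ∈ B})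
    (hB : #B ≤ p.totalDegree)
    (hzero : ∀ A U, B ⊆ A → #A ≤ d → G.IsClosure M A U → ∀ x,
      evalAssignment p x * G.weight U x = 0) :
    SatisfiesIdentity d (G.pseudoExp M) p := by
  intro r hr
  refine linearMap_eq_of_mem_polyOver (L := G.pseudoExp M ∘ₗ LinearMap.mulLeft ℝ p) (L' := 0)
    (fun s hs => ?_) (mem_polyOver_of_totalDegree_le (p := r) le_rfl)
  have hcard : #(B ∪ varSet s) ≤ d := by
    have := card_union_le B (varSet s)
    have : #(varSet s) ≤ r.totalDegree := hs
    omega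
  have hU := G.isClosure_closure M (B ∪ varSet s)
  have hps : p * monomial s 1 ∈
      polyOver {A | A ⊆ G.nbhd (G.closure M (B ∪ varSet s)) ∪ (B ∪ varSet s) ∧ #A ≤ d} := by
    refine mul_mem_polyOver ?_ (mem_polyOver_of_mem_supported hp)
      (monomial_mem_polyOver (Set.mem_singleton (varSet s)) 1)
    rintro A hA _ rfl
    have hAB : A ∪ varSet s ⊆ B ∪ varSet s := union_subset_union hA Subset.rfl
    exact ⟨hAB.trans subset_union_right, (card_le_card hAB).trans hcard⟩
  refine (hU.pseudoExp_eq hG hcard hps).trans ?_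
  rw [map_mul, localExp_apply]
  refine expect_eq_zero fun x _ => ?_
  rw [Pi.mul_apply, mul_right_comm, hzero _ _ subset_union_left hcard hU, zero_mul]

end Pseudoexpectation

end FactorSystem

section Complexity

variable {Ω : Type*} [Fintype Ω] [DecidableEq Ω] {k : ℕ} {P : Predicate Ω k}

theorem SupportsUniform.of_mem_literalFamily {t : ℕ} (h : SupportsUniform P t)
    {L : Set (Equiv.Perm Ω)} {Q : Predicate Ω k} (hQ : Q ∈ literalFamily P L) :
    SupportsUniform Q t := by
  obtain ⟨ℓ, -, rfl⟩ := hQ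
  obtain ⟨μ, ⟨hμ_nonneg, hμ_sum⟩, hμ, hμP⟩ := h
  let e : (Fin k → Ω) ≃ (Fin k → Ω) := Equiv.piCongrRight ℓ
  refine ⟨μ ∘ e, ⟨fun x => hμ_nonneg _, (e.sum_comp μ).trans hμ_sum⟩, fun T hT y => ?_,
    fun x => hμP _⟩
  rw [← hμ T hT (e y)]
  refine sum_equiv e (fun x => ?_) fun x _ => rfl
  simp only [mem_filter_univ]
  exact forall₂_congr fun i _ => (ℓ i).injective.eq_iff.symm

theorem not_supportsUniform_arity [Nonempty Ω] (hP : ∃ x, P x = false) :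
    ¬ SupportsUniform P k := by
  rintro ⟨μ, -, hμ, hμP⟩
  obtain ⟨x, hx⟩ := hP
  have hmass := hμ univ (card_fin k) x
  have hsingleton : ({z | ∀ i ∈ univ, z i = x i} : Finset (Fin k → Ω)) = {x} := by
    ext z
    simp [funext_iff]
  rw [hsingleton, sum_singleton, hμP x hx] at hmass
  exact (inv_pos.2 (pow_pos (Nat.cast_pos.2 Fintype.card_pos) k)).ne hmass

theorem complexity_mem [Nonempty Ω] (hk : 3 ≤ k) (hP : ∃ x, P x = false) :
    complexity P ∈ {τ | 3 ≤ τ ∧ τ ≤ k ∧ ¬ SupportsUniform P τ} :=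
  Nat.sInf_mem ⟨k, hk, le_rfl, not_supportsUniform_arity hP⟩

theorem supportsUniform_complexity_sub_one [Nonempty Ω] (hk : 3 ≤ k) (hP : ∃ x, P x = false)
    (h2 : SupportsUniform P 2) : SupportsUniform P (complexity P - 1) := by
  obtain ⟨h3, hle, -⟩ := complexity_mem hk hP
  rcases h3.eq_or_lt with h | h
  · rwa [← h]
  · by_contra hnot
    have hmin : complexity P ≤ complexity P - 1 := Nat.sInf_le ⟨by omega, by omega, hnot⟩
    omega

end Complexity

theorem one_le_totalDegree_of_eval_ne {σ : Type*} {p : MvPolynomial σ ℝ} {a b : σ → ℝ}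
    (h : eval a p ≠ eval b p) : 1 ≤ p.totalDegree := by
  rw [Nat.one_le_iff_ne_zero]
  intro hp
  rw [totalDegree_eq_zero_iff_eq_C.1 hp, eval_C, eval_C] at h
  exact h rfl

section SatPoly

variable {Ω : Type*} [Fintype Ω] {k n : ℕ} {Q : Predicate Ω k} (S : Fin k ↪ Fin n)

theorem isHomogeneous_satPoly : (satPoly Q S).IsHomogeneous k :=
  IsHomogeneous.sum _ _ _ fun c _ => by
    simpa using IsHomogeneous.prod univ (fun j => (X (S j, c j) : MvPolynomial (Fin n × Ω) ℝ))
      (fun _ => 1) fun j _ => isHomogeneous_X ℝ _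

theorem satPoly_ne_zero (hQ : ∃ c, Q c = true) : satPoly Q S ≠ 0 := by
  obtain ⟨c, hc⟩ := hQ
  intro hzero
  have heval : ((#{c | Q c = true} : ℕ) : ℝ) = 0 := by
    simpa [satPoly] using congrArg (eval fun _ => (1 : ℝ)) hzero
  exact (card_pos.2 ⟨c, (mem_filter_univ c).2 hc⟩).ne' (mod_cast heval)

theorem le_totalDegree_satPoly_sub_one (hk : 0 < k) (hQ : ∃ c, Q c = true) :
    k ≤ (satPoly Q S - 1).totalDegree := by
  have hdeg := (isHomogeneous_satPoly S).totalDegree (satPoly_ne_zero S hQ)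
  rw [sub_eq_add_neg, totalDegree_add_eq_left_of_totalDegree_lt, hdeg]
  rwa [totalDegree_neg, totalDegree_one, hdeg]

theorem satPoly_mem_supported :
    satPoly Q S ∈ supported ℝ {v : Fin n × Ω | v.1 ∈ univ.map S} :=
  Subalgebra.sum_mem _ fun c _ => Subalgebra.prod_mem _ fun j _ =>
    X_mem_supported_fst (mem_map_of_mem S (mem_univ j)) (c j)

theorem evalAssignment_satPoly [DecidableEq Ω] (x : Fin n → Ω) :
    evalAssignment (satPoly Q S) x = if Q (x ∘ S) = true then 1 else 0 := by
  have hprod : ∀ c : Fin k → Ω, (∏ j, if x (S j) = c j then (1 : ℝ) else 0)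
      = if x ∘ S = c then 1 else 0 := fun c => by
    simp [Finset.prod_ite_zero, funext_iff]
  simp only [satPoly, map_sum, map_prod, Finset.sum_apply, Finset.prod_apply, evalAssignment_X,
    hprod, sum_ite_eq, mem_filter_univ]

end SatPoly

namespace FactorSystem

section Identities

variable {ι Ω κ : Type*} [Fintype ι] [DecidableEq ι] [Fintype Ω] [DecidableEq Ω] [Finite κ]
  {k τ M d : ℕ}

theorem satisfiesIdentity_sum_X_sub_one [Nonempty Ω] {G : FactorSystem ι Ω κ k τ}
    (hG : G.HasSmallClosures M d) (i : ι) :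
    SatisfiesIdentity d (G.pseudoExp M) (∑ c : Ω, X (i, c) - 1) := by
  refine satisfiesIdentity_pseudoExp hG (B := {i}) ?_ ?_ fun A U _ _ _ x => ?_
  · exact Subalgebra.sub_mem _
      (Subalgebra.sum_mem _ fun c _ => X_mem_supported_fst (mem_singleton_self i) c) (one_mem _)
  · rw [card_singleton]
    refine one_le_totalDegree_of_eval_ne (a := 0) (b := 1) ?_
    simp [eq_comm (a := (-1 : ℝ)), sub_eq_neg_self]
  · simp [evalAssignment_X]

theorem satisfiesIdentity_X_sq_sub_X {G : FactorSystem ι Ω κ k τ} (hG : G.HasSmallClosures M d)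
    (i : ι) (c : Ω) : SatisfiesIdentity d (G.pseudoExp M) (X (i, c) ^ 2 - X (i, c)) := by
  have hX := X_mem_supported_fst (mem_singleton_self i) c
  refine satisfiesIdentity_pseudoExp hG (B := {i})
    (Subalgebra.sub_mem _ (Subalgebra.pow_mem _ hX 2) hX) ?_ fun A U _ _ _ x => ?_
  · rw [card_singleton]
    refine one_le_totalDegree_of_eval_ne (a := 0) (b := 2) ?_
    norm_num
  · simp [evalAssignment_X]

theorem satisfiesIdentity_satPoly_sub_one {n : ℕ} {G : FactorSystem (Fin n) Ω κ k τ}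
    (hG : G.HasSmallClosures M d) (hM : 0 < d → 0 < M) (hk : 0 < k) (hτ : τ ≤ 2 * k)
    {Q : Predicate Ω k} (hQ : ∃ c, Q c = true) {S : Fin k ↪ Fin n} {f : κ}
    (hf : G.scope f = univ.map S)
    (hdensity : ∀ x, Q (x ∘ S) = false → G.density f x = 0) :
    SatisfiesIdentity d (G.pseudoExp M) (satPoly Q S - 1) := by
  refine satisfiesIdentity_pseudoExp hG (B := univ.map S)
    (Subalgebra.sub_mem _ (satPoly_mem_supported S) (one_mem _)) ?_ fun A U hA hAd hU x => ?_
  · rw [card_map, card_fin]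
    exact le_totalDegree_satPoly_sub_one S hk hQ
  · rw [map_sub, map_one, Pi.sub_apply, evalAssignment_satPoly, Pi.one_apply]
    by_cases hx : Q (x ∘ S) = true
    · rw [if_pos hx, sub_self, zero_mul]
    · have hd : k ≤ d := by simpa using (card_le_card hA).trans hAd
      have hfU : f ∈ U := hU.mem_of_scope_subset hG (hM (hk.trans_le hd)) hτ hAd (hf ▸ hA)
      rw [weight, Finset.prod_apply, prod_eq_zero hfU (hdensity x (by simpa using hx)), mul_zero]

end Identities

end FactorSystem

section Instances

variable {Ω : Type*} {k n m : ℕ} {F : Set (Predicate Ω k)}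

/-- The sets of variables of the constraints of an instance. -/
def scopes (I : CSPInstance F n m) (f : Fin m) : Finset (Fin n) := univ.map (I f).2

theorem card_scopes (I : CSPInstance F n m) (f : Fin m) : #(scopes I f) = k := by
  rw [scopes, card_map, card_univ, Fintype.card_fin]

variable [Fintype Ω]

theorem exists_eq_true_of_mem_stdSimplex {Q : Predicate Ω k} {μ : (Fin k → Ω) → ℝ}
    (hμ : μ ∈ stdSimplex ℝ (Fin k → Ω)) (hμQ : ∀ x, Q x = false → μ x = 0) :
    ∃ x, Q x = true := by
  by_contra! h
  exact zero_ne_one ((sum_eq_zero fun x _ => hμQ x (Bool.eq_false_of_not_eq_true (h x))).symm.trans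
    hμ.2)

variable [DecidableEq Ω]

/-- The densities, on assignments of all variables, of wise uniform distributions attached to the
constraints of an instance. -/
noncomputable def constraintDensities [Nonempty Ω] {τ : ℕ} (hτ : 0 < τ) (hτk : τ ≤ k)
    (I : CSPInstance F n m) {μ : Fin m → (Fin k → Ω) → ℝ} (hμ_nonneg : ∀ f x, 0 ≤ μ f x)
    (hμ : ∀ f, IsWiseUniform (τ - 1) (μ f)) : FactorSystem (Fin n) Ω (Fin m) k τ where
  scope := scopes I
  density f x := (Fintype.card Ω : ℝ) ^ k * μ f (x ∘ (I f).2)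
  card_scope := card_scopes I
  density_nonneg f x := mul_nonneg (by positivity) (hμ_nonneg f _)
  dependsOn_density f x y hxy := by
    have hcomp : x ∘ (I f).2 = y ∘ (I f).2 :=
      funext fun j => hxy _ (mem_coe.2 (mem_map_of_mem _ (mem_univ j)))
    simp only [hcomp]
  expect_mul_density f R hR g hg := by
    refine (hμ f).expect_mul_density (by omega) (I f).2 ?_ hg
    rw [scopes, filter_map, card_map] at hR
    exact Nat.le_sub_one_of_lt hR

theorem sosFailsToRefute_of_isExpanding [Nonempty Ω] {τ M d : ℕ} {ζ : ℝ} (hτ : 0 < τ)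
    (hτk : τ ≤ k) (hF : ∀ Q ∈ F, SupportsUniform Q (τ - 1)) (hζ : 0 < ζ) (hd : 4 * d ≤ ζ * M)
    {I : CSPInstance F n m} (hI : IsExpanding (scopes I) M (k - (τ - ζ) / 2)) :
    SOSFailsToRefute d I := by
  choose μ hμ hμ_uniform hμ_support using fun f => hF _ (I f).1.2
  let G := constraintDensities hτ hτk I (fun f => (hμ f).1) hμ_uniform
  have hG : G.HasSmallClosures M d := FactorSystem.hasSmallClosures_of_isExpanding hζ hd hI
  have hM : 0 < d → 0 < M := fun hd_pos => by
    have hd_pos' : (0 : ℝ) < d := mod_cast hd_pos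
    have hM_pos : (0 : ℝ) < M := (mul_pos_iff_of_pos_left hζ).1 (by linarith)
    exact mod_cast hM_pos
  refine ⟨G.pseudoExp M, FactorSystem.isPseudoexpectation_pseudoExp hG,
    FactorSystem.satisfiesIdentity_sum_X_sub_one hG,
    FactorSystem.satisfiesIdentity_X_sq_sub_X hG, fun f => ?_⟩
  refine FactorSystem.satisfiesIdentity_satPoly_sub_one hG hM (hτ.trans_le hτk) (by omega)
    (exists_eq_true_of_mem_stdSimplex (hμ f) (hμ_support f)) (f := f) rfl fun x hx => ?_
  exact mul_eq_zero_of_right _ (hμ_support f _ hx)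

end Instances

section Estimates

theorem choose_mul_pow_self_le (n v : ℕ) :
    (n.choose v : ℝ) * (v : ℝ) ^ v ≤ (n : ℝ) ^ v * Real.exp v :=
  calc (n.choose v : ℝ) * (v : ℝ) ^ v ≤ (n : ℝ) ^ v / v.factorial * (v : ℝ) ^ v := by
        gcongr
        exact Nat.choose_le_pow_div v n
    _ = (n : ℝ) ^ v * ((v : ℝ) ^ v / v.factorial) := by ring
    _ ≤ (n : ℝ) ^ v * Real.exp v := by
        gcongr
        exact Real.pow_div_factorial_le_exp _ v.cast_nonneg v

theorem choose_le_div_mul_exp_pow (m : ℕ) {c : ℕ} (hc : 0 < c) :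
    (m.choose c : ℝ) ≤ (m / c * Real.exp 1) ^ c := by
  rw [mul_pow, div_pow, ← Real.exp_nat_mul, mul_one, div_mul_eq_mul_div,
    le_div_iff₀ (by positivity)]
  exact choose_mul_pow_self_le m c

theorem choose_mul_div_pow_le {n N v : ℕ} {r y : ℝ} (hn : 0 < n) (hy : 0 < y) (hy1 : y ≤ 1)
    (hvy : (v : ℝ) / n ≤ y) (hr : 0 ≤ r) (hvN : v + r ≤ N) :
    (n.choose v : ℝ) * ((v : ℝ) / n) ^ N ≤ Real.exp N * y ^ r := by
  have hv : (v : ℝ) ≤ N := by linarith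
  have hself : (n.choose v : ℝ) * ((v : ℝ) / n) ^ v ≤ Real.exp N := by
    rw [div_pow, mul_div_assoc', div_le_iff₀ (by positivity), mul_comm (Real.exp _)]
    exact (choose_mul_pow_self_le n v).trans (by gcongr)
  have hrest : ((v : ℝ) / n) ^ (N - v) ≤ y ^ r :=
    calc ((v : ℝ) / n) ^ (N - v) ≤ y ^ (N - v) := by gcongr
      _ = y ^ ((N : ℝ) - v) := by rw [← Nat.cast_sub (mod_cast hv), Real.rpow_natCast]
      _ ≤ y ^ r := Real.rpow_le_rpow_of_exponent_ge hy hy1 (by linarith)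
  rw [← pow_mul_pow_sub ((v : ℝ) / n) (mod_cast hv), ← mul_assoc]
  gcongr

/-- The left-hand side bounds the expected number of sets of `c` constraints that have all their
variables in a set of size `v`. -/
theorem choose_mul_choose_mul_pow_le {k n m c v : ℕ} {Δ θ : ℝ} (hk : 0 < k) (hn : 0 < n)
    (hc : 0 < c) (hm : (m : ℝ) ≤ Δ * n) (hθ : 0 ≤ θ) (hv : (v : ℝ) ≤ (k - θ) * c)
    (hy : (k * c : ℝ) / n ≤ 1) :
    (m.choose c : ℝ) * (n.choose v * (((v : ℝ) / n) ^ k) ^ c)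
      ≤ (Real.exp (k + 1) * k * Δ * ((k * c : ℝ) / n) ^ (θ - 1)) ^ c := by
  set y : ℝ := (k * c : ℝ) / n with hy_def
  have hy_pos : 0 < y := by positivity
  have hΔ : m / c ≤ k * Δ / y := by
    rw [hy_def, div_le_div_iff₀ (by positivity) (by positivity)]
    calc (m : ℝ) * (k * c / n) ≤ Δ * n * (k * c / n) := by gcongr
      _ = k * Δ * c := by field_simp
  have hvars : (n.choose v : ℝ) * (((v : ℝ) / n) ^ k) ^ c ≤ (Real.exp k * y ^ θ) ^ c := by
    have hvN : v + θ * c ≤ (k * c : ℕ) := by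
      push_cast
      linarith
    have hvy : (v : ℝ) / n ≤ y := by
      have : 0 ≤ θ * c := by positivity
      rw [hy_def]
      gcongr
      linarith
    rw [← pow_mul, mul_pow, ← Real.exp_nat_mul, ← Real.rpow_mul_natCast hy_pos.le, mul_comm (c : ℝ)]
    exact mod_cast choose_mul_div_pow_le hn hy_pos hy hvy (by positivity) hvN
  calc (m.choose c : ℝ) * (n.choose v * (((v : ℝ) / n) ^ k) ^ c)
      ≤ (m / c * Real.exp 1) ^ c * (Real.exp k * y ^ θ) ^ c := by
        gcongr
        exact choose_le_div_mul_exp_pow m hc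
    _ ≤ (k * Δ / y * Real.exp 1) ^ c * (Real.exp k * y ^ θ) ^ c := by gcongr
    _ = (Real.exp (k + 1) * k * Δ * y ^ (θ - 1)) ^ c := by
        rw [← mul_pow, Real.rpow_sub_one hy_pos.ne', Real.exp_add]
        ring

theorem exp_mul_le_two_pow {k : ℕ} (hk : 3 ≤ k) : Real.exp (k + 2) * k * 2 ≤ 2 ^ (5 * k) := by
  have hexp : Real.exp (k + 2) ≤ 2 ^ (2 * (k + 2)) := by
    have hcast : ((k + 2 : ℕ) : ℝ) * 1 = k + 2 := by push_cast; ring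
    rw [← hcast, Real.exp_nat_mul, pow_mul]
    gcongr
    linarith [Real.exp_one_lt_d9]
  calc Real.exp (k + 2) * k * 2 ≤ 2 ^ (2 * (k + 2)) * 2 ^ k * 2 := by
        gcongr
        exact mod_cast k.lt_two_pow_self.le
    _ = 2 ^ (3 * k + 5) := by ring
    _ ≤ 2 ^ (5 * k) := pow_le_pow_right₀ one_le_two (by omega)

theorem inv_log_mem_Ioc {Δ : ℝ} (hΔ : Real.exp 2 ≤ Δ) : (Real.log Δ)⁻¹ ∈ Set.Ioc 0 (1 / 2) := by
  have hlog : 2 ≤ Real.log Δ := (Real.le_log_iff_exp_le ((Real.exp_pos 2).trans_le hΔ)).2 hΔ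
  exact ⟨by positivity, by simpa using inv_anti₀ two_pos hlog⟩

/-- The loss `ζ` in the expansion costs a factor `Δ ^ (ζ / (τ - 2))`; this is why `ζ` is chosen
as `1 / log Δ`. -/
theorem mul_rpow_inv_log_le_exp_one {τ Δ : ℝ} (hτ : 3 ≤ τ) (hΔ : 1 < Δ) :
    Δ * (Δ ^ (-(2 / (τ - 2)))) ^ ((τ - (Real.log Δ)⁻¹) / 2 - 1) ≤ Real.exp 1 := by
  have hΔ_pos : 0 < Δ := by linarith
  have hlog : 0 < Real.log Δ := Real.log_pos hΔ
  have hτ2 : 0 < τ - 2 := by linarith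
  have hexponent : 1 + -(2 / (τ - 2)) * ((τ - (Real.log Δ)⁻¹) / 2 - 1)
      = (Real.log Δ)⁻¹ / (τ - 2) := by
    field_simp
    ring
  calc Δ * (Δ ^ (-(2 / (τ - 2)))) ^ ((τ - (Real.log Δ)⁻¹) / 2 - 1)
      = Δ ^ ((Real.log Δ)⁻¹ / (τ - 2)) := by
        rw [← hexponent, ← Real.rpow_mul hΔ_pos.le, Real.rpow_add hΔ_pos, Real.rpow_one]
    _ ≤ Δ ^ (Real.log Δ)⁻¹ :=
        Real.rpow_le_rpow_of_exponent_le hΔ.le (div_le_self (by positivity) (by linarith))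
    _ = Real.exp 1 := by
        rw [Real.rpow_def_of_pos hΔ_pos, mul_inv_cancel₀ hlog.ne']

theorem exp_mul_rpow_le_half {k τ : ℕ} {Δ β y : ℝ} (hτ : 3 ≤ τ) (hτk : τ ≤ k)
    (hΔ : Real.exp 2 ≤ Δ) (hβ : 0 < β) (hβ1 : β ≤ 1) (hy : 0 ≤ y)
    (hyΔ : y ≤ (β / 2 ^ k) ^ (60 / τ : ℝ) * Δ ^ (-(2 / ((τ : ℝ) - 2)))) :
    Real.exp (k + 1) * k * Δ * y ^ ((τ - (Real.log Δ)⁻¹) / 2 - 1) ≤ β / 2 := by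
  obtain ⟨hζ, hζ2⟩ := inv_log_mem_Ioc hΔ
  have hτ3 : (3 : ℝ) ≤ τ := mod_cast hτ
  have hΔ1 : 1 < Δ := (Real.one_lt_exp_iff.2 two_pos).trans_le hΔ
  have hΔloss := mul_rpow_inv_log_le_exp_one hτ3 hΔ1
  set s : ℝ := (τ - (Real.log Δ)⁻¹) / 2 - 1 with hs
  set δ : ℝ := Δ ^ (-(2 / ((τ : ℝ) - 2)))
  have hδ : 0 ≤ δ := Real.rpow_nonneg (by linarith) _
  have hs_nonneg : 0 ≤ s := by linarith
  have hgain : ((β / 2 ^ k) ^ (60 / τ : ℝ)) ^ s ≤ β / 2 ^ (5 * k) :=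
    calc ((β / 2 ^ k) ^ (60 / τ : ℝ)) ^ s = (β / 2 ^ k) ^ (60 / τ * s) :=
          (Real.rpow_mul (by positivity) _ _).symm
      _ ≤ (β / 2 ^ k) ^ (5 : ℝ) := by
          refine Real.rpow_le_rpow_of_exponent_ge (by positivity)
            (div_le_one_of_le₀ (hβ1.trans (one_le_pow₀ one_le_two)) (by positivity)) ?_
          rw [div_mul_eq_mul_div, le_div_iff₀ (by linarith)]
          linarith
      _ = β ^ 5 / 2 ^ (5 * k) := by
          rw [mul_comm 5 k, pow_mul, ← div_pow]
          exact mod_cast Real.rpow_natCast _ 5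
      _ ≤ β / 2 ^ (5 * k) := by
          gcongr
          exact pow_le_of_le_one hβ.le hβ1 (by norm_num)
  calc Real.exp (k + 1) * k * Δ * y ^ s
      ≤ Real.exp (k + 1) * k * Δ * ((β / 2 ^ k) ^ (60 / τ : ℝ) * δ) ^ s := by gcongr
    _ = Real.exp (k + 1) * k * (Δ * δ ^ s) * ((β / 2 ^ k) ^ (60 / τ : ℝ)) ^ s := by
        rw [Real.mul_rpow (by positivity) hδ]
        ring
    _ ≤ Real.exp (k + 1) * k * Real.exp 1 * (β / 2 ^ (5 * k)) := by gcongr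
    _ = Real.exp (k + 2) * k * 2 / 2 ^ (5 * k) * (β / 2) := by
        rw [show (k : ℝ) + 2 = k + 1 + 1 by ring, Real.exp_add (k + 1)]
        ring
    _ ≤ β / 2 := mul_le_of_le_one_left (by positivity)
        (div_le_one_of_le₀ (exp_mul_le_two_pow (hτ.trans hτk)) (by positivity))

theorem sum_half_pow_le {β : ℝ} (hβ : 0 ≤ β) (hβ1 : β ≤ 1) (M : ℕ) :
    ∑ c ∈ Icc 1 M, (β / 2) ^ c ≤ β := by
  suffices h : ∑ c ∈ Icc 1 M, (β / 2) ^ c ≤ β * (1 - (1 / 2) ^ M) from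
    h.trans (mul_le_of_le_one_right hβ (sub_le_self _ (by positivity)))
  induction M with
  | zero => simp
  | succ M ih =>
    have hterm : (β / 2) ^ (M + 1) ≤ β * (1 / 2) ^ (M + 1) := by
      rw [div_eq_mul_one_div, mul_pow]
      gcongr
      exact pow_le_of_le_one hβ hβ1 M.succ_ne_zero
    rw [sum_Icc_succ_top (by omega)]
    calc _ ≤ β * (1 - (1 / 2) ^ M) + β * (1 / 2) ^ (M + 1) := add_le_add ih hterm
      _ = β * (1 - (1 / 2) ^ (M + 1)) := by ring

end Estimates

section DegreeBound

variable {C β Δ : ℝ} {k τ n : ℕ}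

theorem degreeBound_nonneg (hβ : 0 ≤ β) (hΔ : 1 ≤ Δ) : 0 ≤ degreeBound C β Δ k τ n := by
  have hlog := Real.log_nonneg hΔ
  unfold degreeBound
  positivity

theorem mul_degreeBound_mul_log (hβ : 0 ≤ β) (hΔ : 1 < Δ) (hk : 0 < k) :
    k * (degreeBound C β Δ k τ n * Real.log Δ)
      = (β / 2 ^ k) ^ (C / τ) * Δ ^ (-(2 / ((τ : ℝ) - 2))) * n := by
  have hlog := Real.log_pos hΔ
  have htwo : (2 : ℝ) ^ (C * k / τ) = (2 ^ k) ^ (C / τ) := by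
    rw [← Real.rpow_natCast_mul zero_le_two]
    ring_nf
  rw [degreeBound, htwo, Real.div_rpow hβ (by positivity), Real.rpow_neg (by linarith)]
  field_simp

theorem div_le_of_le_degreeBound {c : ℕ} (hτ : 0 < τ) (hτk : τ ≤ k) (hn : 0 < n) (hΔ : 1 < Δ)
    (hβ : 0 < β) (hβ1 : β ≤ 1) (hc : (c : ℝ) ≤ 8 * degreeBound 63 β Δ k τ n * Real.log Δ) :
    (k * c : ℝ) / n ≤ (β / 2 ^ k) ^ (60 / τ : ℝ) * Δ ^ (-(2 / ((τ : ℝ) - 2))) := by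
  have hτ' : (0 : ℝ) < τ := mod_cast hτ
  have heighth : (β / 2 ^ k) ^ (3 / τ : ℝ) ≤ 8⁻¹ :=
    calc (β / 2 ^ k) ^ (3 / τ : ℝ) ≤ ((2 ^ τ)⁻¹) ^ (3 / τ : ℝ) := by
          rw [div_eq_mul_inv]
          gcongr
          exact (mul_le_of_le_one_left (by positivity) hβ1).trans
            (inv_anti₀ (by positivity) (pow_le_pow_right₀ one_le_two hτk))
      _ = 8⁻¹ := by
          rw [Real.inv_rpow (by positivity), ← Real.rpow_natCast_mul zero_le_two,
            mul_div_cancel₀ _ hτ'.ne']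
          norm_num
  rw [div_le_iff₀ (by positivity)]
  calc (k * c : ℝ) ≤ 8 * (k * (degreeBound 63 β Δ k τ n * Real.log Δ)) := by
        rw [mul_left_comm, ← mul_assoc 8]
        gcongr
    _ = 8 * ((β / 2 ^ k) ^ (60 / τ : ℝ) * (β / 2 ^ k) ^ (3 / τ : ℝ)
          * Δ ^ (-(2 / ((τ : ℝ) - 2))) * n) := by
        rw [mul_degreeBound_mul_log hβ.le hΔ (hτ.trans_le hτk), ← Real.rpow_add (by positivity)]
        ring_nf
    _ ≤ 8 * ((β / 2 ^ k) ^ (60 / τ : ℝ) * 8⁻¹ * Δ ^ (-(2 / ((τ : ℝ) - 2))) * n) := by gcongr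
    _ = (β / 2 ^ k) ^ (60 / τ : ℝ) * Δ ^ (-(2 / ((τ : ℝ) - 2))) * n := by ring

end DegreeBound

section Probability

theorem uniformProb_mono {α : Type*} [Finite α] {A B : Set α} (h : A ⊆ B) :
    uniformProb A ≤ uniformProb B := by
  unfold uniformProb
  gcongr
  exact B.toFinite

theorem uniformProb_biUnion_le {α ι : Type*} (s : Finset ι) (A : ι → Set α) :
    uniformProb (⋃ i ∈ s, A i) ≤ ∑ i ∈ s, uniformProb (A i) := by
  unfold uniformProb
  rw [← sum_div]
  gcongr
  exact mod_cast s.set_ncard_biUnion_le A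

theorem uniformProb_biUnion_le_card_mul {α ι : Type*} {s : Finset ι} {A : ι → Set α} {r : ℝ}
    (h : ∀ i ∈ s, uniformProb (A i) ≤ r) : uniformProb (⋃ i ∈ s, A i) ≤ #s * r :=
  (uniformProb_biUnion_le s A).trans ((sum_le_card_nsmul s _ r h).trans_eq (nsmul_eq_mul _ _))

theorem uniformProb_pi_le {α κ : Type*} [Finite α] [Finite κ] (U : Finset κ) (B : Set α) :
    uniformProb {I : κ → α | ∀ f ∈ U, I f ∈ B} ≤ uniformProb B ^ #U := by
  classical
  cases nonempty_fintype α
  cases nonempty_fintype κ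
  have hset : {I : κ → α | ∀ f ∈ U, I f ∈ B}
      = (Fintype.piFinset fun f => if f ∈ U then B.toFinset else univ : Finset (κ → α)) := by
    ext I
    rw [mem_coe, Fintype.mem_piFinset]
    refine forall_congr' fun f => ?_
    by_cases h : f ∈ U <;> simp [h]
  have hprod : uniformProb B ^ #U = ∏ f : κ, if f ∈ U then uniformProb B else 1 := by simp
  have hcard : (Nat.card (κ → α) : ℝ) = ∏ _f : κ, (Fintype.card α : ℝ) := by simp
  rw [hprod, uniformProb, hset, Set.ncard_coe_finset, Fintype.card_piFinset, hcard, Nat.cast_prod,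
    ← prod_div_distrib]
  refine prod_le_prod (fun f _ => by positivity) fun f _ => ?_
  split_ifs
  · rw [uniformProb, Set.ncard_eq_toFinset_card', Nat.card_eq_fintype_card]
  · exact div_self_le_one _

theorem uniformProb_snd_le {α β : Type*} (B : Set β) :
    uniformProb {p : α × β | p.2 ∈ B} ≤ uniformProb B := by
  have hset : {p : α × β | p.2 ∈ B} = Set.univ ×ˢ B := by
    ext
    simp
  rw [uniformProb, uniformProb, hset, Set.ncard_prod, Set.ncard_univ, Nat.card_prod, Nat.cast_mul,
    Nat.cast_mul, mul_div_mul_comm]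
  exact mul_le_of_le_one_left (by positivity) (div_self_le_one _)

theorem descFactorial_mul_pow_le {v n : ℕ} (h : v ≤ n) (k : ℕ) :
    v.descFactorial k * n ^ k ≤ v ^ k * n.descFactorial k := by
  induction k with
  | zero => simp
  | succ k ih =>
    have hstep : (v - k) * n ≤ v * (n - k) := by
      rw [Nat.sub_mul, Nat.mul_sub, mul_comm v k]
      exact Nat.sub_le_sub_left (Nat.mul_le_mul_left k h) _
    calc v.descFactorial (k + 1) * n ^ (k + 1)
        = ((v - k) * n) * (v.descFactorial k * n ^ k) := by
          rw [Nat.descFactorial_succ]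
          ring
      _ ≤ (v * (n - k)) * (v ^ k * n.descFactorial k) := Nat.mul_le_mul hstep ih
      _ = v ^ (k + 1) * n.descFactorial (k + 1) := by
          rw [Nat.descFactorial_succ]
          ring

theorem ncard_embedding_mapsTo {κ α : Type*} [Fintype κ] (V : Finset α) :
    {S : κ ↪ α | ∀ j, S j ∈ V}.ncard = (#V).descFactorial (Fintype.card κ) := by
  classical
  rw [← Nat.card_coe_set_eq, ← Fintype.card_coe V, ← Fintype.card_embedding_eq,
    ← Nat.card_eq_fintype_card]
  exact Nat.card_congr (Equiv.codRestrict κ (V : Set α))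

theorem uniformProb_embedding_mapsTo_le {κ α : Type*} [Fintype κ] [Fintype α] (V : Finset α) :
    uniformProb {S : κ ↪ α | ∀ j, S j ∈ V} ≤ ((#V : ℝ) / Fintype.card α) ^ Fintype.card κ := by
  classical
  rw [uniformProb, ncard_embedding_mapsTo, Nat.card_eq_fintype_card, Fintype.card_embedding_eq,
    div_pow]
  rcases (Nat.descFactorial (Fintype.card α) (Fintype.card κ)).eq_zero_or_pos with hzero | hpos
  · rw [hzero, Nat.cast_zero, div_zero]
    positivity
  · rw [div_le_div_iff₀ (mod_cast hpos) (mod_cast hpos.trans_le (Nat.descFactorial_le_pow _ _))]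
    exact mod_cast descFactorial_mul_pow_le V.card_le_univ _

end Probability

section UnionBound

variable {Ω : Type*} {k n m : ℕ} {F : Set (Predicate Ω k)}

theorem exists_scopes_subset_of_not_isExpanding {I : CSPInstance F n m} {M : ℕ} {a : ℝ}
    (ha : ∀ c ≤ M, a * c ≤ n) (hI : ¬ IsExpanding (scopes I) M a) :
    ∃ c ∈ Icc 1 M, ∃ U ∈ powersetCard c (univ : Finset (Fin m)),
      ∃ V ∈ powersetCard ⌊a * c⌋₊ (univ : Finset (Fin n)), ∀ f ∈ U, scopes I f ⊆ V := by
  obtain ⟨U, hUM, hU⟩ : ∃ U : Finset (Fin m), #U ≤ M ∧ #(U.biUnion (scopes I)) < a * #U := by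
    simpa [IsExpanding] using hI
  have hU_pos : 0 < #U := by
    rw [card_pos, nonempty_iff_ne_empty]
    rintro rfl
    simp at hU
  have hfloor : ⌊a * #U⌋₊ ≤ Fintype.card (Fin n) := by
    rw [Fintype.card_fin, ← Nat.floor_natCast (R := ℝ) n]
    exact Nat.floor_le_floor (ha _ hUM)
  obtain ⟨V, hV, hV_card⟩ := exists_superset_card_eq (Nat.le_floor hU.le) hfloor
  exact ⟨#U, mem_Icc.2 ⟨hU_pos, hUM⟩, U, mem_powersetCard_univ.2 rfl, V,
    mem_powersetCard_univ.2 hV_card, fun f hf => (subset_biUnion_of_mem _ hf).trans hV⟩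

variable [Finite Ω] (F)

theorem uniformProb_forall_scopes_subset_le (U : Finset (Fin m)) (V : Finset (Fin n)) :
    uniformProb {I : CSPInstance F n m | ∀ f ∈ U, scopes I f ⊆ V}
      ≤ (((#V : ℝ) / n) ^ k) ^ #U := by
  have hset : {I : CSPInstance F n m | ∀ f ∈ U, scopes I f ⊆ V}
      = {I | ∀ f ∈ U, I f ∈ {p : F × (Fin k ↪ Fin n) | p.2 ∈ {S | ∀ j, S j ∈ V}}} := by
    ext I
    simp [scopes, subset_iff]
  rw [hset]
  refine (uniformProb_pi_le U _).trans (pow_le_pow_left₀ (by unfold uniformProb; positivity) ?_ _)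
  refine (uniformProb_snd_le _).trans ?_
  simpa using uniformProb_embedding_mapsTo_le (κ := Fin k) V

theorem uniformProb_not_isExpanding_le_sum {M : ℕ} {a : ℝ} (ha : ∀ c ≤ M, a * c ≤ n) :
    uniformProb {I : CSPInstance F n m | ¬ IsExpanding (scopes I) M a}
      ≤ ∑ c ∈ Icc 1 M, (m.choose c : ℝ) *
        (n.choose ⌊a * c⌋₊ * (((⌊a * c⌋₊ : ℝ) / n) ^ k) ^ c) := by
  have hsubset : {I : CSPInstance F n m | ¬ IsExpanding (scopes I) M a}
      ⊆ ⋃ c ∈ Icc 1 M, ⋃ U ∈ powersetCard c (univ : Finset (Fin m)),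
        ⋃ V ∈ powersetCard ⌊a * c⌋₊ (univ : Finset (Fin n)),
          {I | ∀ f ∈ U, scopes I f ⊆ V} := fun I hI => by
    simpa only [Set.mem_iUnion, Set.mem_ofPred_eq, exists_prop] using
      exists_scopes_subset_of_not_isExpanding ha hI
  refine (uniformProb_mono hsubset).trans ((uniformProb_biUnion_le _ _).trans ?_)
  refine sum_le_sum fun c _ => ?_
  refine (uniformProb_biUnion_le_card_mul fun U hU => uniformProb_biUnion_le_card_mul
    (r := (((⌊a * c⌋₊ : ℝ) / n) ^ k) ^ c) fun V hV => ?_).trans_eq ?_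
  · rw [mem_powersetCard_univ] at hU hV
    exact (uniformProb_forall_scopes_subset_le F U V).trans_eq (by rw [hU, hV])
  · simp only [card_powersetCard, card_fin]

theorem uniformProb_not_isExpanding_le {τ : ℕ} {Δ β : ℝ} (hτ : 3 ≤ τ) (hτk : τ ≤ k) (hn : 0 < n)
    (hΔ : Real.exp 2 ≤ Δ) (hm : (m : ℝ) ≤ Δ * n) (hβ : 0 < β) (hβ1 : β ≤ 1) :
    uniformProb {I : CSPInstance F n m |
        ¬ IsExpanding (scopes I) ⌊8 * degreeBound 63 β Δ k τ n * Real.log Δ⌋₊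
          (k - (τ - (Real.log Δ)⁻¹) / 2)} ≤ β := by
  obtain ⟨hζ, hζ2⟩ := inv_log_mem_Ioc hΔ
  have hΔ1 : 1 < Δ := (Real.one_lt_exp_iff.2 two_pos).trans_le hΔ
  have hτ3 : (3 : ℝ) ≤ τ := mod_cast hτ
  have hτk' : (τ : ℝ) ≤ k := mod_cast hτk
  set M := ⌊8 * degreeBound 63 β Δ k τ n * Real.log Δ⌋₊
  have hyΔ (c : ℕ) (hc : c ≤ M) : (k * c : ℝ) / n
      ≤ (β / 2 ^ k) ^ (60 / τ : ℝ) * Δ ^ (-(2 / ((τ : ℝ) - 2))) := by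
    refine div_le_of_le_degreeBound (by omega) hτk hn hΔ1 hβ hβ1 ((Nat.le_floor_iff ?_).1 hc)
    have hD : 0 ≤ degreeBound 63 β Δ k τ n := degreeBound_nonneg hβ.le hΔ1.le
    have hlog := Real.log_pos hΔ1
    positivity
  have hy (c : ℕ) (hc : c ≤ M) : (k * c : ℝ) / n ≤ 1 := by
    refine (hyΔ c hc).trans (mul_le_one₀ ?_ (by positivity) ?_)
    · exact Real.rpow_le_one (by positivity)
        (div_le_one_of_le₀ (hβ1.trans (one_le_pow₀ one_le_two)) (by positivity)) (by positivity)
    · exact Real.rpow_le_one_of_one_le_of_nonpos hΔ1.le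
        (neg_nonpos.2 (div_nonneg zero_le_two (by linarith)))
  have ha (c : ℕ) (hc : c ≤ M) : (k - (τ - (Real.log Δ)⁻¹) / 2) * c ≤ n :=
    calc (k - (τ - (Real.log Δ)⁻¹) / 2) * c ≤ k * c := by
          gcongr
          linarith
      _ ≤ n := (div_le_one₀ (by positivity)).1 (hy c hc)
  refine (uniformProb_not_isExpanding_le_sum F ha).trans
    ((sum_le_sum fun c hc => ?_).trans (sum_half_pow_le hβ.le hβ1 M))
  obtain ⟨hc, hcM⟩ := mem_Icc.1 hc
  have ha_nonneg : 0 ≤ (k - (τ - (Real.log Δ)⁻¹) / 2) * c :=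
    mul_nonneg (by linarith) c.cast_nonneg
  refine (choose_mul_choose_mul_pow_le (by omega) hn hc hm (by linarith)
    (Nat.floor_le ha_nonneg) (hy c hcM)).trans ?_
  gcongr
  exact exp_mul_rpow_le_half hτ hτk hΔ hβ hβ1 (by positivity) (hyΔ c hcM)

end UnionBound

theorem exp_two_le_ten : Real.exp 2 ≤ 10 := by
  rw [← one_add_one_eq_two, Real.exp_add]
  nlinarith [Real.exp_one_lt_three, Real.exp_pos 1]

theorem four_mul_floor_le {D ℓ : ℝ} (hD : 0 ≤ D) (hℓ : 1 ≤ ℓ) :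
    4 * (⌊D⌋₊ : ℝ) ≤ ℓ⁻¹ * ⌊8 * D * ℓ⌋₊ := by
  have hℓ_pos : 0 < ℓ := by linarith
  rw [inv_mul_eq_div, le_div_iff₀ hℓ_pos]
  rcases lt_or_ge D 1 with h | h
  · simp [Nat.floor_eq_zero.2 h]
  · have hfloor : ⌊D⌋₊ * ℓ ≤ D * ℓ := by gcongr; exact Nat.floor_le hD
    have hone : 1 ≤ D * ℓ := one_le_mul_of_one_le_of_one_le h hℓ
    linarith [Nat.lt_floor_add_one (8 * D * ℓ)]

end RandomCSP

theorem theorem8p1_general :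
    ∃ C : ℝ, 0 < C ∧
      ∀ (Ω : Type*) [Fintype Ω] [DecidableEq Ω] [Nonempty Ω] (k τ : ℕ) (F : Set (Predicate Ω k)),
      3 ≤ τ → τ ≤ k → (∀ Q ∈ F, SupportsUniform Q (τ - 1)) →
      ∀ (n m : ℕ) (Δ β : ℝ), k ≤ n → Real.exp 2 ≤ Δ → (m : ℝ) ≤ Δ * n → 0 < β → β ≤ 1 →
        uniformProb {I : CSPInstance F n m |
          ¬ SOSFailsToRefute ⌊degreeBound C β Δ k τ n⌋₊ I} ≤ β := by
  refine ⟨63, by norm_num, ?_⟩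
  intro Ω _ _ _ k τ F hτ hτk hF n m Δ β hkn hΔ hm hβ hβ1
  obtain ⟨hζ, hζ2⟩ := inv_log_mem_Ioc hΔ
  have hD : 0 ≤ degreeBound 63 β Δ k τ n :=
    degreeBound_nonneg hβ.le ((Real.one_le_exp zero_le_two).trans hΔ)
  have hlog : 1 ≤ Real.log Δ := by simpa using (one_le_inv₀ hζ).2 (by linarith)
  have hfails {I : CSPInstance F n m} := sosFailsToRefute_of_isExpanding (I := I) (by omega) hτk hF
    hζ (four_mul_floor_le hD hlog)
  exact (uniformProb_mono fun _ => mt hfails).trans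
    (uniformProb_not_isExpanding_le F hτ hτk (by omega) hΔ hm hβ hβ1)

theorem theorem8p1 :
    ∃ C : ℝ, 0 < C ∧
      ∀ (Ω : Type*) [Fintype Ω] [DecidableEq Ω] (L : Set (Equiv.Perm Ω)), L.Nonempty →
      ∀ (k : ℕ) (P : Predicate Ω k), 3 ≤ k → (∃ x, P x = false) → SupportsUniform P 2 →
      ∀ (n m : ℕ) (Δ β : ℝ), k ≤ n → 10 ≤ Δ → (m : ℝ) = Δ * n → 0 < β → β < 1 →
        uniformProb {I : CSPInstance (literalFamily P L) n m |
          ¬ SOSFailsToRefute ⌊degreeBound C β Δ k (complexity P) n⌋₊ I} ≤ β := by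
  obtain ⟨C, hC, h⟩ := theorem8p1_general
  refine ⟨C, hC, fun Ω _ _ L _ k P hk hP hP2 n m Δ β hkn hΔ hm hβ hβ1 => ?_⟩
  have : Nonempty Ω := ⟨hP.choose ⟨0, by omega⟩⟩
  obtain ⟨hτ, hτk, -⟩ := complexity_mem hk hP
  have hsupport := supportsUniform_complexity_sub_one hk hP hP2
  exact h Ω k (complexity P) _ hτ hτk (fun _ => hsupport.of_mem_literalFamily) n m Δ β hkn
    (exp_two_le_ten.trans hΔ) hm.le hβ hβ1.le
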